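/- **Theorem (Childsnack).** *The domain.* A Childsnack task has finite sets of children, bread portions, content portions, sandwich objects, trays and tables, and one further place, the kitchen. Some bread portions and some content portions are gluten-free, some children are allergic to gluten, and every child sits at a table. Initially all ingredients and all trays are in the kitchen, no sandwich exists, and no child has been served. The actions are: (i) make a not yet existing sandwich in the kitchen from one bread and one content portion, which are used up (the sandwich counts as gluten-free only if it is made by the separate action "make gluten-free sandwich", which requires gluten-free bread and content); (ii) put a sandwich that is in the kitchen on a tray that is in the kitchen; (iii) serve a sandwich from a tray located at a child's table to this child, which consumes the sandwich; an allergic child can be served only a gluten-free sandwich; (iv) move a tray from its place to any place. The goal is that all children are served. A state is a truth valuation of the ground atoms, and a dead end is a state from which no goal state is reachable. An *instance* is a task together with an initial state that is reachable from the initial situation of the task and is not a dead end. The class $\mathcal Q$ of these instances is closed: with an instance it contains every instance that differs from it only in having as initial state a reachable state that is not a dead end. *The sketch.* Consider the features $sk$ (number of sandwiches in the kitchen), $ua$ (number of unserved allergic children), $gfs$ (number of sandwiches that have been made gluten-free, whether or not already served) and $s$ (number of served children), and the sketch $R$ with the rules $$\begin{aligned} r_1&=\{\}\mapsto\{sk?,\,ua?,\,gfs{\uparrow},\,s?\},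 & r_2&=\{\}\mapsto\{sk{\downarrow},\,ua?,\,gfs?,\,s?\}, & r_3&=\{\}\mapsto\{sk?,\,ua{\downarrow},\,gfs?,\,s?\},\\ r_4&=\{ua=0\}\mapsto\{sk{\uparrow},\,ua?,\,gfs?,\,s?\}, & r_5&=\{ua=0\}\mapsto\{sk?,\,ua?,\,gfs?,\,s{\uparrow}\}. \end{aligned}$$ A pair of states $(\sigma,\sigma')$ satisfies a rule if the condition holds in $\sigma$, the features marked $\uparrow$ (resp. $\downarrow$) have a larger (resp. smaller) value in $\sigma'$ than in $\sigma$, and every feature that does not occur among the effects has the same value in both; features marked $?$ may change arbitrarily. Let $G_R(\sigma)$ be the set of all goal states and of all states $\sigma'$ such that $(\sigma,\sigma')$ satisfies a rule, and let $G_R^*(\sigma)$ be the set of those states of $G_R(\sigma)$ that are reachable from $\sigma$ in the least possible number of steps. *Width.* For a planning problem $P$ with initial state $\sigma_0$, the width $w(P)$ is the number of atoms if $P$ is unsolvable, $0$ if $P$ is solvable in at most one step, and otherwise the least $k$ for which there are tuples $t_0,\dots,t_m$ of at most $k$ atoms each such that $t_0$ is true in $\sigma_0$, every optimal plan for $t_i$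 can be extended to an optimal plan for $t_{i+1}$ by adding a single action ($0\le i<m$), and every optimal plan for $t_m$ is an optimal plan for $P$. *Claim.* 1. The class $\mathcal Q$ is closed. 2. $R$ is acyclic in $\mathcal Q$: for every problem in $\mathcal Q$ there are no states $\sigma_0,\dots,\sigma_n$ with $\sigma_n=\sigma_j$ for some $j<n$ such that, for all $i<n$, $\sigma_i$ is not a goal state, $\sigma_{i+1}\in G_R(\sigma_i)$, and $\sigma_{i+1}$ is reachable from $\sigma_i$. 3. $R$ has width $1$ over $\mathcal Q$: for every $P\in\mathcal Q$ with initial state $\sigma$, the set $G_R^*(\sigma)$ contains no dead end, and $\max_{P\in\mathcal Q}w(P')=1$, where $P'$ is $P$ with set of goal states $G_R^*(\sigma)$. 4. In particular, no closest subgoal state is a dead end. -/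

import Mathlib

/-! ### Classical planning -/

/-- A (ground) planning problem with STRIPS actions. The goal is an arbitrary set of states, so that
a problem can be considered with its goal replaced by any set of states. -/
structure PlanningProblem where
  /-- ground atoms -/
  Atom : Type
  /-- ground actions -/
  Action : Type
  /-- preconditions -/
  pre : Action → Set Atom
  /-- positive effects -/
  adds : Action → Set Atom
  /-- negative effects -/
  dels : Action → Set Atom
  /-- initial state, as the set of atoms that it makes true -/
  start : Set Atom
  /-- goal states -/
  goal : Set (Set Atom)

namespace PlanningProblem

/-- A state is a truth valuation of the ground atoms, given by the set of true atoms. -/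
abbrev State (P : PlanningProblem) : Type := Set P.Atom

/-- The state that results from doing `a` in `s`. -/
def succ (P : PlanningProblem) (s : P.State) (a : P.Action) : P.State :=
  (s \ P.dels a) ∪ P.adds a

/-- `P.Exec s π s'`: the action sequence `π` is executable in `s` and leads to `s'`. -/
def Exec (P : PlanningProblem) : P.State → List P.Action → P.State → Prop
  | s, [], s' => s' = s
  | s, a :: π, s' => P.pre a ⊆ s ∧ P.Exec (P.succ s a) π s'

/-- `s'` can be reached from `s` (in zero or more steps). -/
def Reachable (P : PlanningProblem) (s s' : P.State) : Prop := ∃ π, P.Exec s π s'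

/-- `π` leads from `s` to a state in `T`. -/
def IsPlan (P : PlanningProblem) (s : P.State) (T : Set P.State) (π : List P.Action) : Prop :=
  ∃ s' ∈ T, P.Exec s π s'

/-- `π` is a shortest plan from `s` to a state in `T`. -/
def IsOptimalPlan (P : PlanningProblem) (s : P.State) (T : Set P.State) (π : List P.Action) :
    Prop :=
  P.IsPlan s T π ∧ ∀ π', P.IsPlan s T π' → π.length ≤ π'.length

/-- A dead end is a state from which no goal state can be reached. -/
def DeadEnd (P : PlanningProblem) (s : P.State) : Prop := ¬ ∃ π, P.IsPlan s P.goal π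

/-- The states that make all atoms of the tuple `t` true. -/
def models (P : PlanningProblem) (t : Finset P.Atom) : Set P.State := {s | (t : Set P.Atom) ⊆ s}

/-- `P` with initial state `s`. -/
def withStart (P : PlanningProblem) (s : P.State) : PlanningProblem := { P with start := s }

/-- `P` with set of goal states `T`. -/
def withGoal (P : PlanningProblem) (T : Set P.State) : PlanningProblem := { P with goal := T }

/-- `t 0, …, t m` is a chain of tuples of at most `k` atoms that is admissible (the first two
conditions after the size condition) and optimal for `P` (the last condition). -/
def IsOptimalChain (P : PlanningProblem) (k m : ℕ) (t : ℕ → Finset P.Atom) : Prop :=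
  (∀ i ≤ m, (t i).card ≤ k) ∧
  P.start ∈ P.models (t 0) ∧
  (∀ i < m, ∀ π, P.IsOptimalPlan P.start (P.models (t i)) π →
    ∃ a, P.IsOptimalPlan P.start (P.models (t (i + 1))) (π ++ [a])) ∧
  (∀ π, P.IsOptimalPlan P.start (P.models (t m)) π → P.IsOptimalPlan P.start P.goal π)

open Classical in
/-- The width of a planning problem: the number of atoms if the problem is unsolvable, `0` if it is
solvable in at most one step, and otherwise the least size of an optimal admissible chain
(`⊤` if there is none). -/
noncomputable def width (P : PlanningProblem) : ℕ∞ :=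
  if P.DeadEnd P.start then ENat.card P.Atom
  else if ∃ π, P.IsPlan P.start P.goal π ∧ π.length ≤ 1 then 0
  else ⨅ (k : ℕ) (_ : ∃ m t, P.IsOptimalChain k m t), (k : ℕ∞)

end PlanningProblem

/-! ### Sketches -/

namespace Sketch

/-- Valuations of Boolean features indexed by `B` and numerical features indexed by `N`. -/
structure Valuation (B N : Type) where
  /-- values of the Boolean features -/
  bool : B → Prop
  /-- values of the numerical features -/
  num : N → ℕ

/-- Boolean feature conditions `p`, `¬p`, `n = 0`, `n > 0`. -/
inductive Condition (B N : Type)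
  | isTrue (p : B)
  | isFalse (p : B)
  | eqZero (n : N)
  | gtZero (n : N)

/-- Feature effects `p`, `¬p`, `p?`, `n↓`, `n↑`, `n?`. -/
inductive Effect (B N : Type)
  | setTrue (p : B)
  | setFalse (p : B)
  | unkBool (p : B)
  | dec (n : N)
  | inc (n : N)
  | unkNum (n : N)

variable {B N : Type}

/-- The condition holds in the valuation `f`. -/
def Condition.Holds (f : Valuation B N) : Condition B N → Prop
  | .isTrue p => f.bool p
  | .isFalse p => ¬ f.bool p
  | .eqZero n => f.num n = 0
  | .gtZero n => 0 < f.num n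

/-- The effect is satisfied by the change from `f` to `f'`. -/
def Effect.Holds (f f' : Valuation B N) : Effect B N → Prop
  | .setTrue p => f'.bool p
  | .setFalse p => ¬ f'.bool p
  | .unkBool _ => True
  | .dec n => f'.num n < f.num n
  | .inc n => f.num n < f'.num n
  | .unkNum _ => True

/-- The Boolean feature `p` occurs in the effect. -/
def Effect.MentionsBool (p : B) : Effect B N → Prop
  | .setTrue q | .setFalse q | .unkBool q => q = p
  | _ => False

/-- The numerical feature `n` occurs in the effect. -/
def Effect.MentionsNum (n : N) : Effect B N → Prop
  | .dec q | .inc q | .unkNum q => q = n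
  | _ => False

/-- A sketch rule `C ↦ E`. -/
structure Rule (B N : Type) where
  /-- the conditions -/
  conds : Set (Condition B N)
  /-- the effects -/
  effects : Set (Effect B N)

/-- The pair of feature valuations `(f, f')` satisfies the rule: the conditions hold in `f`, the
effects hold, and features that do not occur in the effects keep their value. -/
def Rule.Satisfies (r : Rule B N) (f f' : Valuation B N) : Prop :=
  (∀ c ∈ r.conds, c.Holds f) ∧
  (∀ e ∈ r.effects, e.Holds f f') ∧
  (∀ p, (∀ e ∈ r.effects, ¬ e.MentionsBool p) → (f.bool p ↔ f'.bool p)) ∧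
  (∀ n, (∀ e ∈ r.effects, ¬ e.MentionsNum n) → f.num n = f'.num n)

end Sketch

/-- A sketch over the class of problems `𝒬 i`, `i : ι`: features, which are functions of the states
of the problems of the class, and rules over these features. -/
structure Sketch {ι : Type*} (𝒬 : ι → PlanningProblem) (B N : Type) where
  /-- the feature valuation of a state -/
  features : (i : ι) → (𝒬 i).State → Sketch.Valuation B N
  /-- the rules -/
  rules : Set (Sketch.Rule B N)

namespace Sketch

variable {ι : Type*} {𝒬 : ι → PlanningProblem} {B N : Type}

/-- The subgoal states `G_R(s)`: the goal states, and the states `s'` such that the feature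
valuations of `s` and `s'` satisfy a rule. -/
def subgoals (R : Sketch 𝒬 B N) (i : ι) (s : (𝒬 i).State) : Set (𝒬 i).State :=
  {s' | s' ∈ (𝒬 i).goal ∨ ∃ r ∈ R.rules, r.Satisfies (R.features i s) (R.features i s')}

/-- The closest subgoal states `G*_R(s)`: the subgoal states that are reached from `s` in the least
possible number of steps. -/
def closestSubgoals (R : Sketch 𝒬 B N) (i : ι) (s : (𝒬 i).State) : Set (𝒬 i).State :=
  {s' | s' ∈ R.subgoals i s ∧
    ∃ π, (𝒬 i).Exec s π s' ∧ (𝒬 i).IsOptimalPlan s (R.subgoals i s) π}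

/-- The sketch is (state) acyclic: no sequence of states of a problem of the class, in which every
state but the first is a subgoal state reachable from the preceding one, and in which the search
continues only from states that are not yet goal states, ever returns to an earlier state. -/
def Acyclic (R : Sketch 𝒬 B N) : Prop :=
  ∀ (i : ι) (x : ℕ → (𝒬 i).State) (n : ℕ),
    (∀ l < n, x l ∉ (𝒬 i).goal ∧ x (l + 1) ∈ R.subgoals i (x l) ∧
      (𝒬 i).Reachable (x l) (x (l + 1))) →
    ∀ j < n, x n ≠ x j

/-- No closest subgoal state of an initial state is a dead end. As the class is closed, the initial
states of its problems are all the relevant states. -/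
def NoDeadEnds (R : Sketch 𝒬 B N) : Prop :=
  ∀ i, ∀ s' ∈ R.closestSubgoals i (𝒬 i).start, ¬ (𝒬 i).DeadEnd s'

/-- The width of the sketch over the class is `k`: no closest subgoal state is a dead end, and `k`
is the maximum of the widths of the problems `P'` that are like the problems `P` of the class,
but with the closest subgoal states of the initial state as goal states. -/
def HasWidth (R : Sketch 𝒬 B N) (k : ℕ∞) : Prop :=
  R.NoDeadEnds ∧
  IsGreatest
    (Set.range fun i => ((𝒬 i).withGoal (R.closestSubgoals i (𝒬 i).start)).width) k

/-- A class of problems is closed if with every problem it contains the problems that differ from it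
only in the initial state, which is reachable and not a dead end. -/
def ClosedClass (𝒬 : ι → PlanningProblem) : Prop :=
  ∀ i, ∀ s, (𝒬 i).Reachable (𝒬 i).start s → ¬ (𝒬 i).DeadEnd s → ∃ j, 𝒬 j = (𝒬 i).withStart s

end Sketch

/-! ### The Childsnack domain -/

namespace Childsnack

/-- The objects of a Childsnack task and its static data: which ingredients are gluten-free, which
children are allergic to gluten, and at which table every child sits. -/
structure Task where
  Child : Type
  Bread : Type
  Content : Type
  Sandwich : Type
  Tray : Type
  Table : Type
  [finiteChild : Finite Child]
  [finiteBread : Finite Bread]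
  [finiteContent : Finite Content]
  [finiteSandwich : Finite Sandwich]
  [finiteTray : Finite Tray]
  [finiteTable : Finite Table]
  glutenFreeBread : Set Bread
  glutenFreeContent : Set Content
  allergic : Set Child
  seat : Child → Table

/-- The places are the kitchen and the tables. -/
inductive Place (T : Task)
  | kitchen
  | table (x : T.Table)

/-- The ground atoms. -/
inductive Atom (T : Task)
  | atKitchenBread (b : T.Bread)
  | atKitchenContent (c : T.Content)
  | atKitchenSandwich (s : T.Sandwich)
  | noGlutenBread (b : T.Bread)
  | noGlutenContent (c : T.Content)
  | onTray (s : T.Sandwich) (t : T.Tray)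
  | noGlutenSandwich (s : T.Sandwich)
  | allergicGluten (c : T.Child)
  | notAllergicGluten (c : T.Child)
  | served (c : T.Child)
  | waiting (c : T.Child) (p : Place T)
  | trayAt (t : T.Tray) (p : Place T)
  | notExist (s : T.Sandwich)

/-- The ground actions. -/
inductive Action (T : Task)
  | makeSandwichNoGluten (s : T.Sandwich) (b : T.Bread) (c : T.Content)
  | makeSandwich (s : T.Sandwich) (b : T.Bread) (c : T.Content)
  | putOnTray (s : T.Sandwich) (t : T.Tray)
  | serveSandwichNoGluten (s : T.Sandwich) (c : T.Child) (t : T.Tray) (p : Place T)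
  | serveSandwich (s : T.Sandwich) (c : T.Child) (t : T.Tray) (p : Place T)
  | moveTray (t : T.Tray) (p q : Place T)

variable {T : Task}

/-- Preconditions. -/
def Action.pre : Action T → Set (Atom T)
  | .makeSandwichNoGluten s b c =>
      {.atKitchenBread b, .atKitchenContent c, .noGlutenBread b, .noGlutenContent c, .notExist s}
  | .makeSandwich s b c => {.atKitchenBread b, .atKitchenContent c, .notExist s}
  | .putOnTray s t => {.atKitchenSandwich s, .trayAt t .kitchen}
  | .serveSandwichNoGluten s c t p =>
      {.allergicGluten c, .onTray s t, .waiting c p, .noGlutenSandwich s, .trayAt t p}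
  | .serveSandwich s c t p => {.notAllergicGluten c, .waiting c p, .onTray s t, .trayAt t p}
  | .moveTray t p _ => {.trayAt t p}

/-- Positive effects. -/
def Action.adds : Action T → Set (Atom T)
  | .makeSandwichNoGluten s _ _ => {.atKitchenSandwich s, .noGlutenSandwich s}
  | .makeSandwich s _ _ => {.atKitchenSandwich s}
  | .putOnTray s t => {.onTray s t}
  | .serveSandwichNoGluten _ c _ _ => {.served c}
  | .serveSandwich _ c _ _ => {.served c}
  | .moveTray t _ q => {.trayAt t q}

/-- Negative effects. -/
def Action.dels : Action T → Set (Atom T)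
  | .makeSandwichNoGluten s b c => {.atKitchenBread b, .atKitchenContent c, .notExist s}
  | .makeSandwich s b c => {.atKitchenBread b, .atKitchenContent c, .notExist s}
  | .putOnTray s _ => {.atKitchenSandwich s}
  | .serveSandwichNoGluten s _ t _ => {.onTray s t}
  | .serveSandwich s _ t _ => {.onTray s t}
  | .moveTray t p _ => {.trayAt t p}

/-- The atoms that hold before any action is done: all ingredients and trays are in the kitchen, no
sandwich has been made, and no child has been served. -/
def initially (T : Task) : Set (Atom T) :=
  {x | match x with
    | .atKitchenBread _ => True
    | .atKitchenContent _ => True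
    | .atKitchenSandwich _ => False
    | .noGlutenBread b => b ∈ T.glutenFreeBread
    | .noGlutenContent c => c ∈ T.glutenFreeContent
    | .onTray _ _ => False
    | .noGlutenSandwich _ => False
    | .allergicGluten c => c ∈ T.allergic
    | .notAllergicGluten c => c ∉ T.allergic
    | .served _ => False
    | .waiting c p => p = .table (T.seat c)
    | .trayAt _ p => p = .kitchen
    | .notExist _ => True}

/-- The planning problem of a task: serve all children. -/
def problem (T : Task) : PlanningProblem where
  Atom := Atom T
  Action := Action T
  pre := Action.pre
  adds := Action.adds
  dels := Action.dels
  start := initially T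
  goal := {s | ∀ c, Atom.served c ∈ s}

/-- The instances of the closed class of Childsnack problems: a task, together with an initial state
that is reachable in the planning problem of the task and is not a dead end. -/
structure Instance where
  task : Task
  start : Set (Atom task)
  reachable : (problem task).Reachable (initially task) start
  solvable : ¬ (problem task).DeadEnd start

/-- The planning problem of an instance. -/
def problems (I : Instance) : PlanningProblem := (problem I.task).withStart I.start

/-- The four numerical features: sandwiches in the kitchen, unserved allergic children,
gluten-free sandwiches, served children. -/
inductive Feature
  | sk
  | ua
  | gfs
  | s

/-- The value of a feature in a state. -/
noncomputable def Feature.value (T : Task) (σ : Set (Atom T)) : Feature → ℕ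
  | .sk => {x : T.Sandwich | .atKitchenSandwich x ∈ σ}.ncard
  | .ua => {c : T.Child | .allergicGluten c ∈ σ ∧ .served c ∉ σ}.ncard
  | .gfs => {x : T.Sandwich | .noGlutenSandwich x ∈ σ}.ncard
  | .s => {c : T.Child | .served c ∈ σ}.ncard

open Sketch

/-- `{} ↦ {sk?, ua?, gfs↑, s?}` -/
def r₁ : Rule Empty Feature := ⟨∅, {.unkNum .sk, .unkNum .ua, .inc .gfs, .unkNum .s}⟩

/-- `{} ↦ {sk↓, ua?, gfs?, s?}` -/
def r₂ : Rule Empty Feature := ⟨∅, {.dec .sk, .unkNum .ua, .unkNum .gfs, .unkNum .s}⟩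

/-- `{} ↦ {sk?, ua↓, gfs?, s?}` -/
def r₃ : Rule Empty Feature := ⟨∅, {.unkNum .sk, .dec .ua, .unkNum .gfs, .unkNum .s}⟩

/-- `{ua = 0} ↦ {sk↑, ua?, gfs?, s?}` -/
def r₄ : Rule Empty Feature :=
  ⟨{.eqZero .ua}, {.inc .sk, .unkNum .ua, .unkNum .gfs, .unkNum .s}⟩

/-- `{ua = 0} ↦ {sk?, ua?, gfs?, s↑}` -/
def r₅ : Rule Empty Feature :=
  ⟨{.eqZero .ua}, {.unkNum .sk, .unkNum .ua, .unkNum .gfs, .inc .s}⟩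

/-- The five-rule sketch. -/
noncomputable def sketch : Sketch problems Empty Feature where
  features I σ := { bool := Empty.elim, num := Feature.value I.task σ }
  rules := {r₁, r₂, r₃, r₄, r₅}

end Childsnack

/-! Solvability reduces to counting. A state satisfying the `Invariant` is no dead end iff it is
`Supplied`: the available sandwiches, together with those that can still be made, suffice for the
unserved children, and the gluten-free ones suffice for the unserved allergic children. The
inequalities hold in goal states and pull back along every action (`Supplied.of_step`). Conversely,
every supplied non-goal state leads in at most two steps to a supplied subgoal state with smaller
`work` (`exists_subgoal`).

From a non-goal state, the actions that reach a subgoal state at once are exactly the `Progress`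
actions. The condition `ua = 0` in `r₄` and `r₅` excludes those that waste gluten-free supplies, so
progress keeps a state supplied. If no progress action applies, then a tray is in the wrong place,
and every two-step way to a subgoal state is a tray move followed by progress
(`moveTray_of_isSubgoal`). Hence closest subgoal states are supplied.

For the width, the two-step case has a chain of single atoms: the old place of the tray, its new
place, and then either a sandwich on that tray or a served child. An instance whose only applicable
actions are tray moves shows that width 0 is not enough.

Acyclicity is monotonicity: on a cycle no sandwich is made and no child is newly served, so all
features stay constant and no rule applies. -/

namespace PlanningProblem

variable {P : PlanningProblem}

/-! ### Plans, closest states and width of general planning problems. -/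

theorem exec_append {π ρ : List P.Action} {s s' : P.State} :
    P.Exec s (π ++ ρ) s' ↔ ∃ u, P.Exec s π u ∧ P.Exec u ρ s' := by
  induction π generalizing s with
  | nil => exact ⟨fun h => ⟨s, rfl, h⟩, fun ⟨u, hu, h⟩ => by cases hu; exact h⟩
  | cons a π ih =>
    constructor
    · rintro ⟨ha, h⟩
      obtain ⟨u, hu, h⟩ := ih.1 h
      exact ⟨u, ⟨ha, hu⟩, h⟩
    · rintro ⟨u, ⟨ha, hu⟩, h⟩
      exact ⟨ha, ih.2 ⟨u, hu, h⟩⟩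

theorem exec_withGoal {G : Set P.State} {π : List P.Action} {s s' : P.State} :
    (P.withGoal G).Exec s π s' ↔ P.Exec s π s' := by
  induction π generalizing s with
  | nil => exact Iff.rfl
  | cons a π ih => exact and_congr Iff.rfl ih

theorem exec_withStart {u : P.State} {π : List P.Action} {s s' : P.State} :
    (P.withStart u).Exec s π s' ↔ P.Exec s π s' := by
  induction π generalizing s with
  | nil => exact Iff.rfl
  | cons a π ih => exact and_congr Iff.rfl ih

theorem isPlan_withGoal {G S : Set P.State} {π : List P.Action} {s : P.State} :
    (P.withGoal G).IsPlan s S π ↔ P.IsPlan s S π :=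
  exists_congr fun _ => and_congr Iff.rfl exec_withGoal

theorem isPlan_withStart {u : P.State} {S : Set P.State} {π : List P.Action} {s : P.State} :
    (P.withStart u).IsPlan s S π ↔ P.IsPlan s S π :=
  exists_congr fun _ => and_congr Iff.rfl exec_withStart

theorem isOptimalPlan_withGoal {G S : Set P.State} {π : List P.Action} {s : P.State} :
    (P.withGoal G).IsOptimalPlan s S π ↔ P.IsOptimalPlan s S π :=
  and_congr isPlan_withGoal (forall_congr' fun _ => imp_congr isPlan_withGoal Iff.rfl)

theorem deadEnd_withStart {u s : P.State} : (P.withStart u).DeadEnd s ↔ P.DeadEnd s :=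
  not_congr (exists_congr fun _ => isPlan_withStart)

theorem reachable_withStart {u s s' : P.State} :
    (P.withStart u).Reachable s s' ↔ P.Reachable s s' :=
  exists_congr fun _ => exec_withStart

theorem Reachable.trans {s u v : P.State} (h : P.Reachable s u) (h' : P.Reachable u v) :
    P.Reachable s v := by
  obtain ⟨π, hπ⟩ := h
  obtain ⟨ρ, hρ⟩ := h'
  exact ⟨π ++ ρ, exec_append.2 ⟨u, hπ, hρ⟩⟩

/-- Induction principle for reachability, one action at a time. -/
theorem Exec.induction {p : P.State → Prop}
    (h : ∀ s a, P.pre a ⊆ s → p s → p (P.succ s a)) {π : List P.Action} {s s' : P.State}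
    (hs : p s) (hπ : P.Exec s π s') : p s' := by
  induction π generalizing s with
  | nil => cases hπ; exact hs
  | cons a π ih => exact ih (h s a hπ.1 hs) hπ.2

theorem Exec.refl_trans_induction {r : P.State → P.State → Prop} (hr : ∀ s, r s s)
    (ht : ∀ s u v, r s u → r u v → r s v)
    (h : ∀ s a, P.pre a ⊆ s → r s (P.succ s a)) {π : List P.Action} {s s' : P.State}
    (hπ : P.Exec s π s') : r s s' :=
  Exec.induction (p := r s) (fun u a ha hu => ht _ _ _ hu (h u a ha)) (hr s) hπ

/-- An optimal plan exists as soon as a plan does. -/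
theorem exists_isOptimalPlan {s : P.State} {S : Set P.State} (h : ∃ π, P.IsPlan s S π) :
    ∃ π, P.IsOptimalPlan s S π := by
  classical
  have h' : ∃ n, ∃ π, P.IsPlan s S π ∧ π.length = n := by
    obtain ⟨π, hπ⟩ := h
    exact ⟨_, π, hπ, rfl⟩
  obtain ⟨π, hπ, hl⟩ := Nat.find_spec h'
  exact ⟨π, hπ, fun ρ hρ => hl ▸ Nat.find_min' h' ⟨ρ, hρ, rfl⟩⟩

/-- The states of `S` that are reached from `s` in the least possible number of steps. -/
def closest (P : PlanningProblem) (s : P.State) (S : Set P.State) : Set P.State :=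
  {s' | s' ∈ S ∧ ∃ π, P.Exec s π s' ∧ P.IsOptimalPlan s S π}

/-- Restricting a target set to its closest members removes only endpoints of non-optimal plans.
Widths of subproblems can therefore be computed with all subgoal states as targets. -/
theorem isOptimalPlan_closest {s : P.State} {S : Set P.State} {π : List P.Action} :
    P.IsOptimalPlan s (P.closest s S) π ↔ P.IsOptimalPlan s S π := by
  constructor
  · rintro ⟨⟨s', ⟨hs', ρ, hρ, hopt⟩, hπ⟩, hmin⟩
    refine ⟨⟨s', hs', hπ⟩, fun π' hπ' => ?_⟩
    exact (hmin ρ ⟨s', ⟨hs', ρ, hρ, hopt⟩, hρ⟩).trans (hopt.2 π' hπ')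
  · rintro ⟨⟨s', hs', hπ⟩, hmin⟩
    refine ⟨⟨s', ⟨hs', π, hπ, ⟨s', hs', hπ⟩, hmin⟩, hπ⟩, ?_⟩
    rintro π' ⟨u, hu, hπ'⟩
    exact hmin π' ⟨u, hu.1, hπ'⟩

/-- The empty plan is the only optimal plan for a set that contains the current state. -/
theorem IsOptimalPlan.eq_nil {s : P.State} {S : Set P.State} {π : List P.Action}
    (h : P.IsOptimalPlan s S π) (hs : s ∈ S) : π = [] :=
  List.length_eq_zero_iff.1 (Nat.le_zero.1 (h.2 [] ⟨s, hs, rfl⟩))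

theorem mem_models_singleton {x : P.Atom} {s : P.State} : s ∈ P.models {x} ↔ x ∈ s := by
  simp [models]

/-- A chain of three single atoms is admissible and optimal for the problem of reaching `S` if the
second atom is reached in one step, the third one in one more step, and if every way of reaching the
third atom in at most two steps leads to `S`, which cannot be reached in less than two steps. -/
theorem isOptimalChain_of_two_steps {S : Set P.State} {x₀ x₁ x₂ : P.Atom}
    (hS : ∀ π, P.IsPlan P.start S π → 2 ≤ π.length)
    (h₀ : x₀ ∈ P.start) (h₁ : x₁ ∉ P.start)
    (ha : ∃ a, P.pre a ⊆ P.start ∧ x₁ ∈ P.succ P.start a)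
    (hb : ∀ a, P.pre a ⊆ P.start → x₁ ∈ P.succ P.start a →
      ∃ b, P.pre b ⊆ P.succ P.start a ∧ x₂ ∈ P.succ (P.succ P.start a) b)
    (h₂ : ∀ π s', π.length ≤ 2 → P.Exec P.start π s' → x₂ ∈ s' → s' ∈ S) :
    (P.withGoal (P.closest P.start S)).IsOptimalChain 1 2
      (fun i => if i = 0 then {x₀} else if i = 1 then {x₁} else {x₂}) := by
  obtain ⟨a, hpa, hxa⟩ := ha
  -- A shorter way to `x₂` would by `h₂` be a way to `S` in fewer than two steps.
  have hle : ∀ π, P.IsPlan P.start (P.models {x₂}) π → 2 ≤ π.length := by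
    rintro π ⟨s', hs', hπ⟩
    by_contra hlt
    exact hlt (hS π ⟨s', h₂ π s' (by omega) hπ (mem_models_singleton.1 hs'), hπ⟩)
  have hne : ∀ π, P.IsPlan P.start (P.models {x₁}) π → 1 ≤ π.length := by
    rintro π ⟨s', hs', hπ⟩
    cases π with
    | nil => cases hπ; exact absurd (mem_models_singleton.1 hs') h₁
    | cons => simp
  have hpair : ∀ a, P.pre a ⊆ P.start → x₁ ∈ P.succ P.start a →
      ∃ b, P.IsOptimalPlan P.start (P.models {x₂}) [a, b] := by
    intro a hpa hxa
    obtain ⟨b, hpb, hxb⟩ := hb a hpa hxa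
    exact ⟨b, ⟨_, mem_models_singleton.2 hxb, hpa, hpb, rfl⟩, hle⟩
  refine ⟨fun i _ => ?_, ?_, ?_, ?_⟩
  · dsimp only
    split_ifs <;> exact (Finset.card_singleton _).le
  · exact mem_models_singleton.2 h₀
  · intro i hi π hπ
    replace hπ := isOptimalPlan_withGoal.1 hπ
    suffices h : ∃ a, P.IsOptimalPlan P.start (P.models
        (if i + 1 = 0 then {x₀} else if i + 1 = 1 then {x₁} else {x₂})) (π ++ [a]) from
      h.imp fun _ => isOptimalPlan_withGoal.2
    interval_cases i
    · have : π = [] :=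
        IsOptimalPlan.eq_nil (P := P) hπ (mem_models_singleton.2 h₀)
      subst this
      exact ⟨a, ⟨_, mem_models_singleton.2 hxa, hpa, rfl⟩, hne⟩
    · obtain ⟨⟨s', hs', hπ⟩, hmin⟩ := hπ
      have hl : π.length ≤ 1 := hmin [a] ⟨_, mem_models_singleton.2 hxa, hpa, rfl⟩
      match π, hl, hπ, hs' with
      | [], _, hπ, hs' => cases hπ; exact absurd (mem_models_singleton.1 hs') h₁
      | [a'], _, hπ, hs' =>
        obtain ⟨hpa', rfl⟩ := hπ
        exact hpair a' hpa' (mem_models_singleton.1 hs')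
  · intro π hπ
    replace hπ := isOptimalPlan_withGoal.1 hπ
    obtain ⟨b, hab⟩ := hpair a hpa hxa
    obtain ⟨⟨s', hs', hπ⟩, hmin⟩ := hπ
    have hl : π.length ≤ 2 := hmin _ hab.1
    refine isOptimalPlan_withGoal.2 <| isOptimalPlan_closest.2
      ⟨⟨s', h₂ π s' hl hπ (mem_models_singleton.1 hs'), hπ⟩, ?_⟩
    exact fun π' hπ' => hl.trans (hS π' hπ')

/-- A problem that has an admissible and optimal chain of single atoms has width at most one. -/
theorem width_le_one {m : ℕ} {t : ℕ → Finset P.Atom} (hd : ¬ P.DeadEnd P.start)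
    (h : P.IsOptimalChain 1 m t) : P.width ≤ 1 := by
  unfold width
  rw [if_neg hd]
  split_ifs
  · exact zero_le
  · exact iInf₂_le_of_le 1 ⟨m, t, h⟩ le_rfl

/-- Chains of empty tuples are optimal only if the initial state is a goal state. -/
theorem one_le_width (hd : ¬ P.DeadEnd P.start)
    (h : ¬ ∃ π, P.IsPlan P.start P.goal π ∧ π.length ≤ 1) : 1 ≤ P.width := by
  unfold width
  rw [if_neg hd, if_neg h]
  refine le_iInf₂ fun k hk => ?_
  obtain ⟨m, t, hcard, -, -, hopt⟩ := hk
  rcases Nat.eq_zero_or_pos k with rfl | hk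
  -- For `k = 0` the last tuple is empty, so the empty plan is optimal for it and would have to
  -- reach the goal.
  · have ht : t m = ∅ := Finset.card_eq_zero.1 (Nat.le_zero.1 (hcard m le_rfl))
    have := hopt [] ⟨⟨P.start, by simp [ht, models], rfl⟩, fun _ _ => Nat.zero_le _⟩
    exact absurd ⟨[], this.1, Nat.zero_le _⟩ h
  · exact_mod_cast hk

end PlanningProblem

/-! ### Invariants of reachable states, and the effect of each action on the counts. -/

namespace Childsnack

attribute [instance] Task.finiteChild Task.finiteBread Task.finiteContent Task.finiteSandwich
  Task.finiteTray Task.finiteTable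

variable {T : Task}

/-- The state that results from doing `a` in `σ`. -/
def step (σ : Set (Atom T)) (a : Action T) : Set (Atom T) := (σ \ a.dels) ∪ a.adds

theorem mem_step {σ : Set (Atom T)} {a : Action T} {x : Atom T} :
    x ∈ step σ a ↔ (x ∈ σ ∧ x ∉ a.dels) ∨ x ∈ a.adds := Iff.rfl

/-- The invariants of the reachable states that the counting arguments use. -/
structure Invariant (σ : Set (Atom T)) : Prop where
  waiting : ∀ c, .waiting c (.table (T.seat c)) ∈ σ
  notAllergic_iff : ∀ c, .notAllergicGluten c ∈ σ ↔ .allergicGluten c ∉ σ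
  trayAt : ∀ t, ∃ p, .trayAt t p ∈ σ
  notExist_kitchen : ∀ s, .notExist s ∈ σ → .atKitchenSandwich s ∉ σ
  notExist_onTray : ∀ s t, .notExist s ∈ σ → .onTray s t ∉ σ
  notExist_glutenFree : ∀ s, .notExist s ∈ σ → .noGlutenSandwich s ∉ σ
  kitchen_onTray : ∀ s t, .atKitchenSandwich s ∈ σ → .onTray s t ∉ σ
  onTray_unique : ∀ s t t', .onTray s t ∈ σ → .onTray s t' ∈ σ → t = t'

theorem Invariant.initially : Invariant (initially T) := by
  constructor <;> simp [Childsnack.initially]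

theorem Invariant.step {σ : Set (Atom T)} (h : Invariant σ) {a : Action T} (ha : a.pre ⊆ σ) :
    Invariant (step σ a) := by
  obtain ⟨h1, h2, h3, h4, h5, h6, h7, h8⟩ := h
  have h9 : ∀ t, ∃ p, .trayAt t p ∈ Childsnack.step σ a := by
    intro t
    obtain ⟨p, hp⟩ := h3 t
    -- If the tray is moved away from `p`, its destination is the new witness; this also covers `q =
    -- p`, because adding comes after deleting.
    by_cases h : ∃ q, a = .moveTray t p q
    · obtain ⟨q, rfl⟩ := h
      exact ⟨q, Or.inr rfl⟩
    · refine ⟨p, Or.inl ⟨hp, fun hd => h ?_⟩⟩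
      cases a <;> simp_all [Action.dels]
  cases a <;>
  simp only [Action.pre, Set.insert_subset_iff, Set.singleton_subset_iff] at ha <;>
  refine ⟨?_, ?_, h9, ?_, ?_, ?_, ?_, ?_⟩ <;>
  simp only [mem_step, Action.dels, Action.adds, Set.mem_insert_iff, Set.mem_singleton_iff,
    reduceCtorEq, Atom.atKitchenSandwich.injEq, Atom.onTray.injEq, Atom.noGlutenSandwich.injEq,
    Atom.notExist.injEq, or_false, false_or, not_false_eq_true, and_true] <;>
  grind

/-- The numbers of objects of various kinds in a state. -/
structure Counts where
  /-- sandwiches not yet made -/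
  unmade : ℕ
  /-- remaining bread portions -/
  bread : ℕ
  /-- remaining content portions -/
  content : ℕ
  /-- remaining gluten-free bread portions -/
  breadGF : ℕ
  /-- remaining gluten-free content portions -/
  contentGF : ℕ
  /-- sandwiches in the kitchen or on a tray -/
  avail : ℕ
  /-- gluten-free sandwiches in the kitchen or on a tray -/
  availGF : ℕ
  /-- unserved children -/
  unserved : ℕ
  /-- unserved allergic children -/
  ua : ℕ
  /-- sandwiches in the kitchen -/
  sk : ℕ
  /-- gluten-free sandwiches, served or not -/
  gfs : ℕ

/-- The numbers of objects of the various kinds in the state `σ`. -/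
noncomputable def counts (σ : Set (Atom T)) : Counts where
  unmade := {s : T.Sandwich | .notExist s ∈ σ}.ncard
  bread := {b : T.Bread | .atKitchenBread b ∈ σ}.ncard
  content := {c : T.Content | .atKitchenContent c ∈ σ}.ncard
  breadGF := {b : T.Bread | .atKitchenBread b ∈ σ ∧ .noGlutenBread b ∈ σ}.ncard
  contentGF := {c : T.Content | .atKitchenContent c ∈ σ ∧ .noGlutenContent c ∈ σ}.ncard
  avail := {s : T.Sandwich | .atKitchenSandwich s ∈ σ ∨ ∃ t, .onTray s t ∈ σ}.ncard
  availGF := {s : T.Sandwich |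
    (.atKitchenSandwich s ∈ σ ∨ ∃ t, .onTray s t ∈ σ) ∧ .noGlutenSandwich s ∈ σ}.ncard
  unserved := {c : T.Child | .served c ∉ σ}.ncard
  ua := {c : T.Child | .allergicGluten c ∈ σ ∧ .served c ∉ σ}.ncard
  sk := {s : T.Sandwich | .atKitchenSandwich s ∈ σ}.ncard
  gfs := {s : T.Sandwich | .noGlutenSandwich s ∈ σ}.ncard

section ncard

variable {α : Type*} {X Y : Set α}

theorem ncard_congr_mem (h : ∀ y, y ∈ X ↔ y ∈ Y) : X.ncard = Y.ncard := by
  rw [Set.ext h]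

theorem ncard_add_one_eq [Finite α] (x : α) (hx : x ∈ Y) (h : ∀ y, y ∈ X ↔ y ∈ Y ∧ y ≠ x) :
    X.ncard + 1 = Y.ncard := by
  rw [show X = Y \ {x} from Set.ext h]
  exact Set.ncard_sdiff_singleton_add_one hx

end ncard

variable {σ : Set (Atom T)}

/-- The invariant ensures that a sandwich not yet made was counted neither as available nor as
gluten-free, so these counts grow by exactly one. -/
theorem counts_makeSandwichNoGluten (h : Invariant σ) {s : T.Sandwich} {b : T.Bread}
    {c : T.Content} (ha : (Action.makeSandwichNoGluten s b c).pre ⊆ σ) :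
    (counts (step σ (.makeSandwichNoGluten s b c))).unmade + 1 = (counts σ).unmade ∧
    (counts (step σ (.makeSandwichNoGluten s b c))).bread + 1 = (counts σ).bread ∧
    (counts (step σ (.makeSandwichNoGluten s b c))).content + 1 = (counts σ).content ∧
    (counts (step σ (.makeSandwichNoGluten s b c))).breadGF + 1 = (counts σ).breadGF ∧
    (counts (step σ (.makeSandwichNoGluten s b c))).contentGF + 1 = (counts σ).contentGF ∧
    (counts (step σ (.makeSandwichNoGluten s b c))).avail = (counts σ).avail + 1 ∧
    (counts (step σ (.makeSandwichNoGluten s b c))).availGF = (counts σ).availGF + 1 ∧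
    (counts (step σ (.makeSandwichNoGluten s b c))).unserved = (counts σ).unserved ∧
    (counts (step σ (.makeSandwichNoGluten s b c))).ua = (counts σ).ua ∧
    (counts (step σ (.makeSandwichNoGluten s b c))).sk = (counts σ).sk + 1 ∧
    (counts (step σ (.makeSandwichNoGluten s b c))).gfs = (counts σ).gfs + 1 := by
  simp only [Action.pre, Set.insert_subset_iff, Set.singleton_subset_iff] at ha
  obtain ⟨hb, hc, hbg, hcg, hs⟩ := ha
  have h1 := h.notExist_kitchen s hs
  have h2 := h.notExist_onTray s
  have h3 := h.notExist_glutenFree s hs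
  refine ⟨ncard_add_one_eq s ?_ ?_, ncard_add_one_eq b ?_ ?_, ncard_add_one_eq c ?_ ?_,
    ncard_add_one_eq b ?_ ?_, ncard_add_one_eq c ?_ ?_, (ncard_add_one_eq s ?_ ?_).symm,
    (ncard_add_one_eq s ?_ ?_).symm, ncard_congr_mem ?_, ncard_congr_mem ?_,
    (ncard_add_one_eq s ?_ ?_).symm, (ncard_add_one_eq s ?_ ?_).symm⟩ <;>
  simp [mem_step, Action.dels, Action.adds, hb, hc, hbg, hcg, hs] <;> grind

/-- Only inequalities hold for `breadGF` and `contentGF`, since gluten-free ingredients may go into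
an ordinary sandwich. -/
theorem counts_makeSandwich (h : Invariant σ) {s : T.Sandwich} {b : T.Bread}
    {c : T.Content} (ha : (Action.makeSandwich s b c).pre ⊆ σ) :
    (counts (step σ (.makeSandwich s b c))).unmade + 1 = (counts σ).unmade ∧
    (counts (step σ (.makeSandwich s b c))).bread + 1 = (counts σ).bread ∧
    (counts (step σ (.makeSandwich s b c))).content + 1 = (counts σ).content ∧
    (counts (step σ (.makeSandwich s b c))).breadGF ≤ (counts σ).breadGF ∧
    (counts (step σ (.makeSandwich s b c))).contentGF ≤ (counts σ).contentGF ∧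
    (counts (step σ (.makeSandwich s b c))).avail = (counts σ).avail + 1 ∧
    (counts (step σ (.makeSandwich s b c))).availGF = (counts σ).availGF ∧
    (counts (step σ (.makeSandwich s b c))).unserved = (counts σ).unserved ∧
    (counts (step σ (.makeSandwich s b c))).ua = (counts σ).ua ∧
    (counts (step σ (.makeSandwich s b c))).sk = (counts σ).sk + 1 ∧
    (counts (step σ (.makeSandwich s b c))).gfs = (counts σ).gfs := by
  simp only [Action.pre, Set.insert_subset_iff, Set.singleton_subset_iff] at ha
  obtain ⟨hb, hc, hs⟩ := ha
  have h1 := h.notExist_kitchen s hs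
  have h2 := h.notExist_onTray s
  have h3 := h.notExist_glutenFree s hs
  refine ⟨ncard_add_one_eq s ?_ ?_, ncard_add_one_eq b ?_ ?_, ncard_add_one_eq c ?_ ?_,
    Set.ncard_le_ncard ?_, Set.ncard_le_ncard ?_, (ncard_add_one_eq s ?_ ?_).symm,
    ncard_congr_mem ?_, ncard_congr_mem ?_, ncard_congr_mem ?_,
    (ncard_add_one_eq s ?_ ?_).symm, ncard_congr_mem ?_⟩ <;>
  simp [mem_step, Action.dels, Action.adds, hb, hc, hs] <;> grind

theorem counts_putOnTray {s : T.Sandwich} {t : T.Tray}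
    (ha : (Action.putOnTray s t).pre ⊆ σ) :
    (counts (step σ (.putOnTray s t))).unmade = (counts σ).unmade ∧
    (counts (step σ (.putOnTray s t))).bread = (counts σ).bread ∧
    (counts (step σ (.putOnTray s t))).content = (counts σ).content ∧
    (counts (step σ (.putOnTray s t))).breadGF = (counts σ).breadGF ∧
    (counts (step σ (.putOnTray s t))).contentGF = (counts σ).contentGF ∧
    (counts (step σ (.putOnTray s t))).avail = (counts σ).avail ∧
    (counts (step σ (.putOnTray s t))).availGF = (counts σ).availGF ∧
    (counts (step σ (.putOnTray s t))).unserved = (counts σ).unserved ∧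
    (counts (step σ (.putOnTray s t))).ua = (counts σ).ua ∧
    (counts (step σ (.putOnTray s t))).sk + 1 = (counts σ).sk ∧
    (counts (step σ (.putOnTray s t))).gfs = (counts σ).gfs := by
  simp only [Action.pre, Set.insert_subset_iff, Set.singleton_subset_iff] at ha
  obtain ⟨hs, ht⟩ := ha
  refine ⟨ncard_congr_mem ?_, ncard_congr_mem ?_, ncard_congr_mem ?_, ncard_congr_mem ?_,
    ncard_congr_mem ?_, ncard_congr_mem ?_, ncard_congr_mem ?_, ncard_congr_mem ?_,
    ncard_congr_mem ?_, ncard_add_one_eq s ?_ ?_, ncard_congr_mem ?_⟩ <;>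
  simp [mem_step, Action.dels, Action.adds, hs] <;> grind

/-- A sandwich is in at most one location, so deleting a single `onTray` atom makes it unavailable.
The two cases are needed because the preconditions allow serving a child again. -/
theorem counts_serveSandwichNoGluten (h : Invariant σ) {s : T.Sandwich} {c : T.Child} {t : T.Tray}
    {p : Place T} (ha : (Action.serveSandwichNoGluten s c t p).pre ⊆ σ) :
    (counts (step σ (.serveSandwichNoGluten s c t p))).unmade = (counts σ).unmade ∧
    (counts (step σ (.serveSandwichNoGluten s c t p))).bread = (counts σ).bread ∧
    (counts (step σ (.serveSandwichNoGluten s c t p))).content = (counts σ).content ∧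
    (counts (step σ (.serveSandwichNoGluten s c t p))).breadGF = (counts σ).breadGF ∧
    (counts (step σ (.serveSandwichNoGluten s c t p))).contentGF = (counts σ).contentGF ∧
    (counts (step σ (.serveSandwichNoGluten s c t p))).avail + 1 = (counts σ).avail ∧
    (counts (step σ (.serveSandwichNoGluten s c t p))).availGF + 1 = (counts σ).availGF ∧
    (counts (step σ (.serveSandwichNoGluten s c t p))).sk = (counts σ).sk ∧
    (counts (step σ (.serveSandwichNoGluten s c t p))).gfs = (counts σ).gfs ∧
    (.served c ∉ σ →
      (counts (step σ (.serveSandwichNoGluten s c t p))).unserved + 1 = (counts σ).unserved ∧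
      (counts (step σ (.serveSandwichNoGluten s c t p))).ua + 1 = (counts σ).ua) ∧
    (.served c ∈ σ →
      (counts (step σ (.serveSandwichNoGluten s c t p))).unserved = (counts σ).unserved ∧
      (counts (step σ (.serveSandwichNoGluten s c t p))).ua = (counts σ).ua) := by
  simp only [Action.pre, Set.insert_subset_iff, Set.singleton_subset_iff] at ha
  obtain ⟨hc, hst, hp, hs, ht⟩ := ha
  have h1 := h.kitchen_onTray s t
  have h2 := h.onTray_unique s t
  refine ⟨ncard_congr_mem ?_, ncard_congr_mem ?_, ncard_congr_mem ?_, ncard_congr_mem ?_,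
    ncard_congr_mem ?_, ncard_add_one_eq s ?_ ?_, ncard_add_one_eq s ?_ ?_, ncard_congr_mem ?_,
    ncard_congr_mem ?_, fun hu => ⟨ncard_add_one_eq c ?_ ?_, ncard_add_one_eq c ?_ ?_⟩,
    fun hu => ⟨ncard_congr_mem ?_, ncard_congr_mem ?_⟩⟩ <;>
  simp [mem_step, Action.dels, Action.adds] <;> grind

/-- A non-allergic child may receive a gluten-free sandwich, hence the inequality for `availGF`;
`ua` is unchanged because the recipient is not allergic. -/
theorem counts_serveSandwich (h : Invariant σ) {s : T.Sandwich} {c : T.Child} {t : T.Tray}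
    {p : Place T} (ha : (Action.serveSandwich s c t p).pre ⊆ σ) :
    (counts (step σ (.serveSandwich s c t p))).unmade = (counts σ).unmade ∧
    (counts (step σ (.serveSandwich s c t p))).bread = (counts σ).bread ∧
    (counts (step σ (.serveSandwich s c t p))).content = (counts σ).content ∧
    (counts (step σ (.serveSandwich s c t p))).breadGF = (counts σ).breadGF ∧
    (counts (step σ (.serveSandwich s c t p))).contentGF = (counts σ).contentGF ∧
    (counts (step σ (.serveSandwich s c t p))).avail + 1 = (counts σ).avail ∧
    (counts (step σ (.serveSandwich s c t p))).availGF ≤ (counts σ).availGF ∧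
    (counts (step σ (.serveSandwich s c t p))).sk = (counts σ).sk ∧
    (counts (step σ (.serveSandwich s c t p))).gfs = (counts σ).gfs ∧
    (counts (step σ (.serveSandwich s c t p))).ua = (counts σ).ua ∧
    (.served c ∉ σ →
      (counts (step σ (.serveSandwich s c t p))).unserved + 1 = (counts σ).unserved) ∧
    (.served c ∈ σ →
      (counts (step σ (.serveSandwich s c t p))).unserved = (counts σ).unserved) := by
  simp only [Action.pre, Set.insert_subset_iff, Set.singleton_subset_iff] at ha
  obtain ⟨hc, hp, hst, ht⟩ := ha
  have h1 := h.kitchen_onTray s t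
  have h2 := h.onTray_unique s t
  have h3 := h.notAllergic_iff c
  refine ⟨ncard_congr_mem ?_, ncard_congr_mem ?_, ncard_congr_mem ?_, ncard_congr_mem ?_,
    ncard_congr_mem ?_, ncard_add_one_eq s ?_ ?_, Set.ncard_le_ncard ?_, ncard_congr_mem ?_,
    ncard_congr_mem ?_, ncard_congr_mem ?_, fun hu => ncard_add_one_eq c ?_ ?_,
    fun hu => ncard_congr_mem ?_⟩ <;>
  simp [mem_step, Action.dels, Action.adds] <;> grind

theorem counts_moveTray {t : T.Tray} {p q : Place T} :
    counts (step σ (.moveTray t p q)) = counts σ := by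
  simp [counts, mem_step, Action.dels, Action.adds]

end Childsnack

/-! ### Subgoals in terms of counts, and the actions that reach them. -/

namespace Childsnack

variable {T : Task} {σ : Set (Atom T)}

theorem ua_le_unserved : (counts σ).ua ≤ (counts σ).unserved :=
  Set.ncard_le_ncard fun _ h => h.2

theorem unserved_eq_zero_iff : (counts σ).unserved = 0 ↔ ∀ c, .served c ∈ σ := by
  rw [counts, Set.ncard_eq_zero, Set.eq_empty_iff_forall_notMem]
  exact forall_congr' fun c => not_not

theorem served_or_of_ua_eq_zero (h : (counts σ).ua = 0) (c : T.Child) :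
    .allergicGluten c ∉ σ ∨ .served c ∈ σ := by
  have h' := (Set.ncard_eq_zero (Set.toFinite _)).1 h
  by_contra! hc
  exact Set.eq_empty_iff_forall_notMem.1 h' c hc

/-- The subgoal relation of the sketch, in terms of the counts. -/
def IsSubgoal (σ σ' : Set (Atom T)) : Prop :=
  (counts σ').unserved = 0 ∨ (counts σ).gfs < (counts σ').gfs ∨ (counts σ').sk < (counts σ).sk ∨
    (counts σ').ua < (counts σ).ua ∨ ((counts σ).ua = 0 ∧ (counts σ).sk < (counts σ').sk) ∨
    ((counts σ).ua = 0 ∧ (counts σ').unserved < (counts σ).unserved)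

/-- The actions that lead to a subgoal state at once. -/
def Progress (σ : Set (Atom T)) : Action T → Prop
  | .makeSandwichNoGluten _ _ _ => True
  | .makeSandwich _ _ _ => (counts σ).ua = 0
  | .putOnTray _ _ => True
  | .serveSandwichNoGluten _ c _ _ => .served c ∉ σ
  | .serveSandwich _ c _ _ => (counts σ).ua = 0 ∧ .served c ∉ σ
  | .moveTray _ _ _ => False

theorem Progress.isSubgoal (h : Invariant σ) {a : Action T} (ha : a.pre ⊆ σ)
    (hp : Progress σ a) : IsSubgoal σ (step σ a) := by
  unfold IsSubgoal
  cases a with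
  | makeSandwichNoGluten s b c => have := counts_makeSandwichNoGluten h ha; omega
  | makeSandwich s b c =>
    have := counts_makeSandwich h ha
    simp only [Progress] at hp
    omega
  | putOnTray s t => have := counts_putOnTray ha; omega
  | serveSandwichNoGluten s c t p =>
    obtain ⟨_, _, _, _, _, _, _, _, _, h1, -⟩ := counts_serveSandwichNoGluten h ha
    have := h1 hp
    omega
  | serveSandwich s c t p =>
    obtain ⟨_, _, _, _, _, _, _, _, _, _, h1, -⟩ := counts_serveSandwich h ha
    have := h1 hp.2
    have := hp.1
    omega
  | moveTray t p q => exact hp.elim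

/-- What remains are tray moves, repeated servings, and ordinary sandwiches made or served while an
allergic child is unserved. The last two kinds may change `sk` or `unserved`, but only where `r₄`
and `r₅` are disabled. -/
theorem counts_step_of_not_progress (h : Invariant σ) {a : Action T} (ha : a.pre ⊆ σ)
    (hp : ¬ Progress σ a) :
    (counts (step σ a)).gfs = (counts σ).gfs ∧ (counts (step σ a)).ua = (counts σ).ua ∧
    (counts σ).sk ≤ (counts (step σ a)).sk ∧
    ((counts σ).ua = 0 → (counts (step σ a)).sk = (counts σ).sk ∧
      (counts (step σ a)).unserved = (counts σ).unserved) := by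
  cases a with
  | makeSandwichNoGluten s b c => exact (hp trivial).elim
  | makeSandwich s b c =>
    have := counts_makeSandwich h ha
    simp only [Progress] at hp
    omega
  | putOnTray s t => exact (hp trivial).elim
  | serveSandwichNoGluten s c t p =>
    obtain ⟨_, _, _, _, _, _, _, _, _, -, h1⟩ := counts_serveSandwichNoGluten h ha
    have := h1 (not_not.1 hp)
    omega
  | serveSandwich s c t p =>
    obtain ⟨_, _, _, _, _, _, _, _, _, _, -, h1⟩ := counts_serveSandwich h ha
    refine ⟨by omega, by omega, by omega, fun h0 => ?_⟩
    have := h1 (by by_contra hc; exact hp ⟨h0, hc⟩)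
    omega
  | moveTray t p q => simp [counts_moveTray]

theorem progress_of_isSubgoal (h : Invariant σ) (hσ : (counts σ).unserved ≠ 0) {a : Action T}
    (ha : a.pre ⊆ σ) (hs : IsSubgoal σ (step σ a)) : Progress σ a := by
  by_contra hp
  have h1 := counts_step_of_not_progress h ha hp
  -- This excludes the goal case: if `ua` was positive it still is, so some child is unserved.
  have h2 := ua_le_unserved (σ := step σ a)
  unfold IsSubgoal at hs
  omega

/-- Whether an action counts as progress depends only on `ua` and on the served children, not on its
applicability. -/
theorem Progress.of_step {a b : Action T} (hua : (counts (step σ a)).ua = (counts σ).ua)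
    (hs : ∀ c, .served c ∈ σ → .served c ∈ step σ a) (hb : Progress (step σ a) b) :
    Progress σ b := by
  cases b with
  | makeSandwichNoGluten => trivial
  | makeSandwich => exact hua.symm.trans hb
  | putOnTray => trivial
  | serveSandwichNoGluten _ c => exact fun h => hb (hs c h)
  | serveSandwich _ c => exact ⟨hua.symm.trans hb.1, fun h => hb.2 (hs c h)⟩
  | moveTray => exact hb

theorem served_step {c : T.Child} (hc : .served c ∈ σ) (a : Action T) : .served c ∈ step σ a := by
  cases a <;> simp [mem_step, Action.dels, hc]

theorem pre_subset_of_step {a b : Action T} (hb : b.pre ⊆ step σ a)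
    (h : ∀ x ∈ a.adds, x ∉ b.pre) : b.pre ⊆ σ := fun x hx =>
  (hb hx).elim And.left fun hx' => (h x hx' hx).elim

theorem served_notMem_pre (c : T.Child) (b : Action T) : .served c ∉ b.pre := by
  cases b <;> simp [Action.pre]

/-- If no subgoal state can be reached in one step, then two steps lead to a subgoal state only if
the first one moves a tray. -/
theorem moveTray_of_isSubgoal (h : Invariant σ) (hσ : (counts σ).unserved ≠ 0)
    (hno : ∀ a : Action T, a.pre ⊆ σ → ¬ Progress σ a) {a b : Action T} (ha : a.pre ⊆ σ)
    (hb : b.pre ⊆ step σ a) (hs : IsSubgoal σ (step (step σ a) b)) :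
    (∃ t p q, a = .moveTray t p q) ∧ Progress (step σ a) b := by
  have h1 := counts_step_of_not_progress h ha (hno a ha)
  have hp : Progress (step σ a) b := by
    by_contra hp
    have h2 := counts_step_of_not_progress (h.step ha) hb hp
    have h3 := ua_le_unserved (σ := step (step σ a) b)
    unfold IsSubgoal at hs
    omega
  refine ⟨?_, hp⟩
  have hpσ : Progress σ b := hp.of_step h1.2.1 fun c hc => served_step hc a
  -- Otherwise `b` alone would already be progress. So `a` must add a precondition of `b`, which
  -- rules out most pairs of actions.
  have hb' : ¬ b.pre ⊆ σ := fun hb' => hno b hb' hpσ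
  cases a with
  | makeSandwichNoGluten s b c => exact (hno _ ha trivial).elim
  | makeSandwich s d c =>
    have hua : (counts σ).ua ≠ 0 := hno _ ha
    cases b with
    -- The new sandwich raises `sk` by one and putting a sandwich on a tray lowers it again; since
    -- `ua` stays positive, no rule and no goal is met.
    | putOnTray s' t =>
      have h2 := counts_makeSandwich h ha
      have h3 := counts_putOnTray hb
      have h4 := ua_le_unserved (σ := step (step σ (.makeSandwich s d c)) (.putOnTray s' t))
      unfold IsSubgoal at hs
      omega
    | _ =>
      refine (hb' (pre_subset_of_step hb fun x hx => ?_)).elim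
      obtain rfl : x = .atKitchenSandwich s := hx
      simp [Action.pre]
  | putOnTray s t => exact (hno _ ha trivial).elim
  | serveSandwichNoGluten s c t p =>
    refine (hb' (pre_subset_of_step hb fun x hx => ?_)).elim
    obtain rfl : x = .served c := hx
    exact served_notMem_pre c b
  | serveSandwich s c t p =>
    refine (hb' (pre_subset_of_step hb fun x hx => ?_)).elim
    obtain rfl : x = .served c := hx
    exact served_notMem_pre c b
  | moveTray t p q => exact ⟨t, p, q, rfl⟩

/-! ### Sufficient supplies and their equivalence with solvability. -/

/-- The available and still possible sandwiches suffice for the unserved children, and the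
gluten-free ones suffice for the unserved allergic children. -/
structure Supplied (σ : Set (Atom T)) : Prop where
  tray : Nonempty T.Tray ∨ (counts σ).unserved = 0
  unmade : (counts σ).unserved ≤ (counts σ).avail + (counts σ).unmade
  bread : (counts σ).unserved ≤ (counts σ).avail + (counts σ).bread
  content : (counts σ).unserved ≤ (counts σ).avail + (counts σ).content
  unmadeGF : (counts σ).ua ≤ (counts σ).availGF + (counts σ).unmade
  breadGF : (counts σ).ua ≤ (counts σ).availGF + (counts σ).breadGF
  contentGF : (counts σ).ua ≤ (counts σ).availGF + (counts σ).contentGF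

theorem Supplied.of_unserved_eq_zero (h : (counts σ).unserved = 0) : Supplied σ := by
  have := ua_le_unserved (σ := σ)
  constructor <;> omega

/-- No action creates supplies: making a sandwich turns potential into available ones, and a serving
uses up one sandwich for at most one child. A tray is witnessed by any action that uses one. -/
theorem Supplied.of_step (h : Invariant σ) {a : Action T} (ha : a.pre ⊆ σ)
    (hs : Supplied (step σ a)) : Supplied σ := by
  obtain ⟨h1, h2, h3, h4, h5, h6, h7⟩ := hs
  cases a with
  | makeSandwichNoGluten s b c =>
    have := counts_makeSandwichNoGluten h ha
    exact ⟨h1.imp_right (by omega), by omega, by omega, by omega, by omega, by omega, by omega⟩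
  | makeSandwich s b c =>
    have := counts_makeSandwich h ha
    exact ⟨h1.imp_right (by omega), by omega, by omega, by omega, by omega, by omega, by omega⟩
  | putOnTray s t => exact ⟨.inl ⟨t⟩, by have := counts_putOnTray ha; omega,
      by have := counts_putOnTray ha; omega, by have := counts_putOnTray ha; omega,
      by have := counts_putOnTray ha; omega, by have := counts_putOnTray ha; omega,
      by have := counts_putOnTray ha; omega⟩
  | serveSandwichNoGluten s c t p =>
    obtain ⟨_, _, _, _, _, _, _, _, _, h8, h9⟩ := counts_serveSandwichNoGluten h ha
    by_cases hc : .served c ∈ σ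
    · have := h9 hc
      exact ⟨.inl ⟨t⟩, by omega, by omega, by omega, by omega, by omega, by omega⟩
    · have := h8 hc
      exact ⟨.inl ⟨t⟩, by omega, by omega, by omega, by omega, by omega, by omega⟩
  | serveSandwich s c t p =>
    obtain ⟨_, _, _, _, _, _, _, _, _, _, h8, h9⟩ := counts_serveSandwich h ha
    by_cases hc : .served c ∈ σ
    · have := h9 hc
      exact ⟨.inl ⟨t⟩, by omega, by omega, by omega, by omega, by omega, by omega⟩
    · have := h8 hc
      exact ⟨.inl ⟨t⟩, by omega, by omega, by omega, by omega, by omega, by omega⟩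
  | moveTray t p q =>
    rw [counts_moveTray] at *
    exact ⟨h1, h2, h3, h4, h5, h6, h7⟩

theorem Supplied.moveTray (h : Supplied σ) (t : T.Tray) (p q : Place T) :
    Supplied (step σ (.moveTray t p q)) := by
  obtain ⟨h1, h2, h3, h4, h5, h6, h7⟩ := h
  constructor <;> rwa [counts_moveTray]

/-- A number that decreases with every action that makes progress. -/
noncomputable def work (σ : Set (Atom T)) : ℕ :=
  -- Making a sandwich raises `sk` by one, so an unmade sandwich must weigh two.
  2 * (counts σ).unmade + (counts σ).sk + (counts σ).unserved

theorem work_moveTray (t : T.Tray) (p q : Place T) : work (step σ (.moveTray t p q)) = work σ := by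
  rw [work, counts_moveTray, work]

/-- Useful servings lower demand and supply together. Ordinary sandwiches are made or served only
when `ua = 0`, where the gluten-free inequalities are trivial. -/
theorem Progress.supplied (h : Invariant σ) (hs : Supplied σ) {a : Action T} (ha : a.pre ⊆ σ)
    (hp : Progress σ a) : Supplied (step σ a) ∧ work (step σ a) < work σ := by
  obtain ⟨h1, h2, h3, h4, h5, h6, h7⟩ := hs
  unfold work
  cases a with
  | makeSandwichNoGluten s b c =>
    have := counts_makeSandwichNoGluten h ha
    exact ⟨⟨h1.imp_right (by omega), by omega, by omega, by omega, by omega, by omega, by omega⟩,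
      by omega⟩
  | makeSandwich s b c =>
    have := counts_makeSandwich h ha
    simp only [Progress] at hp
    exact ⟨⟨h1.imp_right (by omega), by omega, by omega, by omega, by omega, by omega, by omega⟩,
      by omega⟩
  | putOnTray s t =>
    have := counts_putOnTray ha
    exact ⟨⟨.inl ⟨t⟩, by omega, by omega, by omega, by omega, by omega, by omega⟩, by omega⟩
  | serveSandwichNoGluten s c t p =>
    obtain ⟨_, _, _, _, _, _, _, _, _, h8, -⟩ := counts_serveSandwichNoGluten h ha
    have := h8 hp
    exact ⟨⟨.inl ⟨t⟩, by omega, by omega, by omega, by omega, by omega, by omega⟩, by omega⟩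
  | serveSandwich s c t p =>
    obtain ⟨_, _, _, _, _, _, _, _, _, _, h8, -⟩ := counts_serveSandwich h ha
    have := h8 hp.2
    have := hp.1
    exact ⟨⟨.inl ⟨t⟩, by omega, by omega, by omega, by omega, by omega, by omega⟩, by omega⟩
  | moveTray t p q => exact hp.elim

/-- A sandwich is in the kitchen, but the tray `t` is not. -/
def NeedsTray (σ : Set (Atom T)) (s : T.Sandwich) (t : T.Tray) : Prop :=
  .atKitchenSandwich s ∈ σ ∧ .trayAt t .kitchen ∉ σ

/-- The sandwich `s`, which is fit for the child `c`, is on the tray `t`, which is not at the table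
of the child. The child is unserved, and it is allergic if any unserved child is. -/
def NeedsDelivery (σ : Set (Atom T)) (s : T.Sandwich) (t : T.Tray) (c : T.Child) : Prop :=
  .onTray s t ∈ σ ∧ .trayAt t (.table (T.seat c)) ∉ σ ∧ .served c ∉ σ ∧
    (.allergicGluten c ∈ σ ∧ .noGlutenSandwich s ∈ σ ∨
      .allergicGluten c ∉ σ ∧ (counts σ).ua = 0)

/-- A sandwich that is fit for a child that is to be served gives rise to progress or is one tray
move away from it. -/
theorem exists_progress_of_avail (h : Invariant σ) [Nonempty T.Tray] {s : T.Sandwich} {c : T.Child}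
    (hs : .atKitchenSandwich s ∈ σ ∨ ∃ t, .onTray s t ∈ σ) (hc : .served c ∉ σ)
    (hsc : .allergicGluten c ∈ σ ∧ .noGlutenSandwich s ∈ σ ∨
      .allergicGluten c ∉ σ ∧ (counts σ).ua = 0) :
    (∃ a : Action T, a.pre ⊆ σ ∧ Progress σ a) ∨ (∃ s t, NeedsTray σ s t) ∨
      ∃ s t c, NeedsDelivery σ s t c := by
  rcases hs with hs | ⟨t, hs⟩
  · obtain ⟨t⟩ := ‹Nonempty T.Tray›
    by_cases ht : .trayAt t .kitchen ∈ σ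
    · refine .inl ⟨.putOnTray s t, ?_, trivial⟩
      simp [Action.pre, Set.insert_subset_iff, hs, ht]
    · exact .inr (.inl ⟨s, t, hs, ht⟩)
  · by_cases ht : .trayAt t (.table (T.seat c)) ∈ σ
    · rcases hsc with ⟨hca, hsg⟩ | ⟨hca, hua⟩
      · refine .inl ⟨.serveSandwichNoGluten s c t (.table (T.seat c)), ?_, hc⟩
        simp [Action.pre, Set.insert_subset_iff, hs, ht, hca, hsg, h.waiting]
      · refine .inl ⟨.serveSandwich s c t (.table (T.seat c)), ?_, hua, hc⟩
        simp [Action.pre, Set.insert_subset_iff, hs, ht, hca, h.notAllergic_iff, h.waiting]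
    · exact .inr (.inr ⟨s, t, c, hs, ht, hc, hsc⟩)

/-- Allergic children take priority: while one is unserved, only gluten-free sandwiches are
considered. If no suitable sandwich is available, the supply inequalities provide the ingredients
and an unmade sandwich object. -/
theorem exists_progress (h : Invariant σ) (hs : Supplied σ) (hσ : (counts σ).unserved ≠ 0) :
    (∃ a : Action T, a.pre ⊆ σ ∧ Progress σ a) ∨ (∃ s t, NeedsTray σ s t) ∨
      ∃ s t c, NeedsDelivery σ s t c := by
  have htray : Nonempty T.Tray := hs.tray.resolve_right hσ
  by_cases hua : (counts σ).ua = 0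
  · by_cases hav : (counts σ).avail = 0
    · have h1 := hs.unmade
      have h2 := hs.bread
      have h3 := hs.content
      obtain ⟨s, hs⟩ := Set.nonempty_of_ncard_ne_zero
        (show (counts σ).unmade ≠ 0 by omega)
      obtain ⟨b, hb⟩ := Set.nonempty_of_ncard_ne_zero
        (show (counts σ).bread ≠ 0 by omega)
      obtain ⟨c, hc⟩ := Set.nonempty_of_ncard_ne_zero
        (show (counts σ).content ≠ 0 by omega)
      refine .inl ⟨.makeSandwich s b c, ?_, hua⟩
      exact Set.insert_subset hb (Set.insert_subset hc (Set.singleton_subset_iff.2 hs))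
    · obtain ⟨s, hs⟩ := Set.nonempty_of_ncard_ne_zero hav
      obtain ⟨c, hc⟩ := Set.nonempty_of_ncard_ne_zero hσ
      exact exists_progress_of_avail h hs hc
        (.inr ⟨(served_or_of_ua_eq_zero hua c).resolve_right hc, hua⟩)
  · by_cases hav : (counts σ).availGF = 0
    · have h1 := hs.unmadeGF
      have h2 := hs.breadGF
      have h3 := hs.contentGF
      obtain ⟨s, hs⟩ := Set.nonempty_of_ncard_ne_zero
        (show (counts σ).unmade ≠ 0 by omega)
      obtain ⟨b, hb⟩ := Set.nonempty_of_ncard_ne_zero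
        (show (counts σ).breadGF ≠ 0 by omega)
      obtain ⟨c, hc⟩ := Set.nonempty_of_ncard_ne_zero
        (show (counts σ).contentGF ≠ 0 by omega)
      refine .inl ⟨.makeSandwichNoGluten s b c, ?_, trivial⟩
      exact Set.insert_subset hb.1 (Set.insert_subset hc.1 (Set.insert_subset hb.2
        (Set.insert_subset hc.2 (Set.singleton_subset_iff.2 hs))))
    · obtain ⟨s, hs⟩ := Set.nonempty_of_ncard_ne_zero hav
      obtain ⟨c, hc⟩ := Set.nonempty_of_ncard_ne_zero hua
      exact exists_progress_of_avail h hs.1 hc.2 (.inl ⟨hc.1, hs.2⟩)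

theorem NeedsTray.progress {s : T.Sandwich} {t : T.Tray} (h : NeedsTray σ s t) (p : Place T) :
    (Action.putOnTray s t).pre ⊆ step σ (.moveTray t p .kitchen) := by
  have := h.1
  simp [Action.pre, Set.insert_subset_iff, mem_step, Action.adds, Action.dels, this]

theorem NeedsDelivery.progress (hi : Invariant σ) {s : T.Sandwich} {t : T.Tray} {c : T.Child}
    (h : NeedsDelivery σ s t c) (p : Place T) :
    ∃ b : Action T, b.pre ⊆ step σ (.moveTray t p (.table (T.seat c))) ∧
      Progress (step σ (.moveTray t p (.table (T.seat c)))) b ∧ .served c ∈ b.adds := by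
  obtain ⟨hs, -, hc, ⟨hca, hsg⟩ | ⟨hca, hua⟩⟩ := h
  · refine ⟨.serveSandwichNoGluten s c t (.table (T.seat c)), ?_, ?_, rfl⟩
    · simp [Action.pre, Set.insert_subset_iff, mem_step, Action.adds, Action.dels, hs, hca, hsg,
        hi.waiting]
    · simp [Progress, mem_step, Action.adds, hc]
  · refine ⟨.serveSandwich s c t (.table (T.seat c)), ?_, ?_, rfl⟩
    · simp [Action.pre, Set.insert_subset_iff, mem_step, Action.adds, Action.dels, hs, hca,
        hi.waiting, hi.notAllergic_iff]
    · simp [Progress, mem_step, Action.adds, hc, counts_moveTray, hua]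

/-- From a state with sufficient supplies, a subgoal state with less work and sufficient supplies is
reached in one or two steps. -/
theorem exists_subgoal (h : Invariant σ) (hs : Supplied σ) (hσ : (counts σ).unserved ≠ 0) :
    ∃ π σ', π.length ≤ 2 ∧ (problem T).Exec σ π σ' ∧ IsSubgoal σ σ' ∧ Invariant σ' ∧
      Supplied σ' ∧ work σ' < work σ := by
  -- A tray move changes no count, so a subgoal relative to the moved state is one relative to `σ`,
  -- and `work` can be compared directly.
  have key : ∀ t p q b, .trayAt t p ∈ σ → b.pre ⊆ step σ (.moveTray t p q) →
      Progress (step σ (.moveTray t p q)) b →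
      ∃ π σ', π.length ≤ 2 ∧ (problem T).Exec σ π σ' ∧ IsSubgoal σ σ' ∧ Invariant σ' ∧
        Supplied σ' ∧ work σ' < work σ := by
    intro t p q b ht hb hp
    have ha : (Action.moveTray t p q).pre ⊆ σ := Set.singleton_subset_iff.2 ht
    obtain ⟨h1, h2⟩ := hp.supplied (h.step ha) (hs.moveTray t p q) hb
    refine ⟨[.moveTray t p q, b], _, le_rfl, ⟨ha, hb, rfl⟩, ?_, (h.step ha).step hb, h1, ?_⟩
    · have := hp.isSubgoal (h.step ha) hb
      unfold IsSubgoal at this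
      rwa [counts_moveTray] at this
    · rwa [work_moveTray] at h2
  rcases exists_progress h hs hσ with ⟨a, ha, hp⟩ | ⟨s, t, hst⟩ | ⟨s, t, c, hst⟩
  · obtain ⟨h1, h2⟩ := hp.supplied h hs ha
    exact ⟨[a], step σ a, one_le_two, ⟨ha, rfl⟩, hp.isSubgoal h ha, h.step ha, h1, h2⟩
  · obtain ⟨p, hp⟩ := h.trayAt t
    exact key t p .kitchen _ hp (hst.progress p) trivial
  · obtain ⟨p, hp⟩ := h.trayAt t
    obtain ⟨b, hb, hpb, -⟩ := hst.progress h p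
    exact key t p _ b hp hb hpb

/-- Sufficient supplies exclude dead ends. -/
theorem Supplied.not_deadEnd (h : Invariant σ) (hs : Supplied σ) : ¬ (problem T).DeadEnd σ := by
  refine not_not.2 ?_
  induction hn : work σ using Nat.strong_induction_on generalizing σ with
  | _ n ih =>
    by_cases hσ : (counts σ).unserved = 0
    · exact ⟨[], σ, unserved_eq_zero_iff.1 hσ, rfl⟩
    · obtain ⟨π, σ', -, hπ, -, h1, h2, h3⟩ := exists_subgoal h hs hσ
      obtain ⟨ρ, τ, hτ, hρ⟩ := ih _ (hn ▸ h3) h1 h2 rfl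
      exact ⟨π ++ ρ, τ, hτ, PlanningProblem.exec_append.2 ⟨σ', hπ, hρ⟩⟩

/-- A state that is not a dead end has sufficient supplies. -/
theorem supplied_of_not_deadEnd (h : Invariant σ) (hd : ¬ (problem T).DeadEnd σ) :
    Supplied σ := by
  obtain ⟨π, τ, hτ, hπ⟩ := not_not.1 hd
  clear hd
  induction π generalizing σ with
  | nil => cases hπ; exact .of_unserved_eq_zero (unserved_eq_zero_iff.2 hτ)
  | cons a π ih => exact (ih (h.step hπ.1) hπ.2).of_step h hπ.1

theorem Invariant.of_reachable (h : (problem T).Reachable (Childsnack.initially T) σ) :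
    Invariant σ := by
  obtain ⟨π, hπ⟩ := h
  exact PlanningProblem.Exec.induction (p := Invariant) (fun _ _ ha h => h.step ha)
    Invariant.initially hπ

end Childsnack

/-! ### The sketch in terms of counts, closedness and acyclicity. -/

namespace Childsnack

open PlanningProblem

variable {T : Task} {σ : Set (Atom T)}

theorem value_served_add_unserved :
    Feature.value T σ .s + (counts σ).unserved = Nat.card T.Child :=
  Set.ncard_add_ncard_compl {c : T.Child | Atom.served c ∈ σ}

/-- The subgoal states of the sketch are given by `IsSubgoal`. -/
theorem mem_subgoals (I : Instance) (σ σ' : Set (Atom I.task)) :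
    σ' ∈ sketch.subgoals I σ ↔ IsSubgoal σ σ' := by
  have h1 := value_served_add_unserved (σ := σ)
  have h2 := value_served_add_unserved (σ := σ')
  have hs : (counts σ').unserved < (counts σ).unserved ↔
    Feature.value I.task σ .s < Feature.value I.task σ' .s := by omega
  -- Every rule mentions all four features and there are no Boolean ones, so the frame conditions
  -- are void.
  have key : ∀ e₁ e₂ e₃ e₄ : Sketch.Effect Empty Feature, e₁.MentionsNum .sk →
      e₂.MentionsNum .ua → e₃.MentionsNum .gfs → e₄.MentionsNum .s →
      ∀ C f f', Sketch.Rule.Satisfies ⟨C, {e₁, e₂, e₃, e₄}⟩ f f' ↔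
        (∀ c ∈ C, c.Holds f) ∧ e₁.Holds f f' ∧ e₂.Holds f f' ∧ e₃.Holds f f' ∧
          e₄.Holds f f' := by
    intro e₁ e₂ e₃ e₄ m₁ m₂ m₃ m₄ C f f'
    refine ⟨fun h => ⟨h.1, ?_⟩, fun h => ⟨h.1, ?_, fun p => p.elim, fun n hn => ?_⟩⟩
    · simpa using h.2.1
    · simpa using h.2
    · simp only [Set.mem_insert_iff, Set.mem_singleton_iff, forall_eq_or_imp, forall_eq] at hn
      cases n
      · exact (hn.1 m₁).elim
      · exact (hn.2.1 m₂).elim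
      · exact (hn.2.2.1 m₃).elim
      · exact (hn.2.2.2 m₄).elim
  have hrules : (∃ r ∈ sketch.rules, r.Satisfies (sketch.features I σ) (sketch.features I σ')) ↔
      (counts σ).gfs < (counts σ').gfs ∨ (counts σ').sk < (counts σ).sk ∨
      (counts σ').ua < (counts σ).ua ∨ ((counts σ).ua = 0 ∧ (counts σ).sk < (counts σ').sk) ∨
      ((counts σ).ua = 0 ∧ (counts σ').unserved < (counts σ).unserved) := by
    rw [hs]
    simp only [sketch, Set.mem_insert_iff, Set.mem_singleton_iff, exists_eq_or_imp,
      exists_eq_left]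
    rw [r₁, r₂, r₃, r₄, r₅,
      key (.unkNum .sk) (.unkNum .ua) (.inc .gfs) (.unkNum .s) rfl rfl rfl rfl,
      key (.dec .sk) (.unkNum .ua) (.unkNum .gfs) (.unkNum .s) rfl rfl rfl rfl,
      key (.unkNum .sk) (.dec .ua) (.unkNum .gfs) (.unkNum .s) rfl rfl rfl rfl,
      key (.inc .sk) (.unkNum .ua) (.unkNum .gfs) (.unkNum .s) rfl rfl rfl rfl,
      key (.unkNum .sk) (.unkNum .ua) (.unkNum .gfs) (.inc .s) rfl rfl rfl rfl]
    simp [Sketch.Effect.Holds, Sketch.Condition.Holds, Feature.value, counts]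
  exact or_congr unserved_eq_zero_iff.symm hrules

theorem Instance.invariant (I : Instance) : Invariant I.start := .of_reachable I.reachable

theorem Instance.supplied (I : Instance) : Supplied I.start :=
  supplied_of_not_deadEnd I.invariant I.solvable

/-- The class is closed. -/
theorem closedClass_problems : Sketch.ClosedClass problems := fun I s hs hd =>
  ⟨⟨I.task, s, I.reachable.trans (reachable_withStart.1 hs),
    fun h => hd (deadEnd_withStart.2 h)⟩, rfl⟩

/-- What a state and a state reachable from it have in common: fewer sandwiches are left to be made,
more sandwiches are gluten-free, more children are served, the allergic children are the same, and
no sandwich appears in the kitchen unless it was made. -/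
structure Later (σ σ' : Set (Atom T)) : Prop where
  notExist : ∀ s, .notExist s ∈ σ' → .notExist s ∈ σ
  glutenFree : ∀ s, .noGlutenSandwich s ∈ σ → .noGlutenSandwich s ∈ σ'
  served : ∀ c, .served c ∈ σ → .served c ∈ σ'
  allergic : ∀ c, .allergicGluten c ∈ σ ↔ .allergicGluten c ∈ σ'
  kitchen : (∀ s, .notExist s ∈ σ → .notExist s ∈ σ') →
    ∀ s, .atKitchenSandwich s ∈ σ' → .atKitchenSandwich s ∈ σ

theorem Later.trans {σ₁ σ₂ σ₃ : Set (Atom T)} (h : Later σ₁ σ₂) (h' : Later σ₂ σ₃) :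
    Later σ₁ σ₃ where
  notExist s hs := h.notExist s (h'.notExist s hs)
  glutenFree s hs := h'.glutenFree s (h.glutenFree s hs)
  served c hc := h'.served c (h.served c hc)
  allergic c := (h.allergic c).trans (h'.allergic c)
  -- Since `notExist` only shrinks, nothing made on the whole way means nothing made on either part.
  kitchen hn s hs := h.kitchen (fun x hx => h'.notExist x (hn x hx)) s
    (h'.kitchen (fun x hx => hn x (h.notExist x hx)) s hs)

theorem Later.refl (σ : Set (Atom T)) : Later σ σ :=
  ⟨fun _ => id, fun _ => id, fun _ => id, fun _ => Iff.rfl, fun _ _ => id⟩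

theorem Later.step {a : Action T} (ha : a.pre ⊆ σ) : Later σ (step σ a) := by
  cases a <;>
  simp only [Action.pre, Set.insert_subset_iff, Set.singleton_subset_iff] at ha <;>
  constructor <;> simp [mem_step, Action.dels, Action.adds] <;> grind

theorem Later.of_exec {π : List (Action T)} {σ' : Set (Atom T)}
    (h : (problem T).Exec σ π σ') : Later σ σ' :=
  Exec.refl_trans_induction (P := problem T) (r := Later) Later.refl
    (fun _ _ _ => Later.trans) (fun _ _ => Later.step) h

/-- States that are reachable from each other have no subgoals in each other. -/
theorem not_isSubgoal_of_later {σ' : Set (Atom T)} (h : Later σ σ') (h' : Later σ' σ)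
    (hσ : (counts σ).unserved ≠ 0) : ¬ IsSubgoal σ σ' := by
  have h1 : (counts σ').gfs = (counts σ).gfs :=
    ncard_congr_mem fun s => ⟨h'.glutenFree s, h.glutenFree s⟩
  have h2 : (counts σ').sk = (counts σ).sk :=
    ncard_congr_mem fun s => ⟨h.kitchen h'.notExist s, h'.kitchen h.notExist s⟩
  have hs : ∀ c, .served c ∈ σ' ↔ .served c ∈ σ := fun c => ⟨h'.served c, h.served c⟩
  have h3 : (counts σ').unserved = (counts σ).unserved :=
    ncard_congr_mem fun c => not_congr (hs c)
  have h4 : (counts σ').ua = (counts σ).ua :=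
    ncard_congr_mem fun c => and_congr (h'.allergic c) (not_congr (hs c))
  unfold IsSubgoal
  omega

/-- On a cycle `x (j + 1)` leads back to `x n = x j`, so these two states are `Later` than each
other. -/
theorem acyclic_sketch : sketch.Acyclic := by
  intro I x n hx j hj heq
  have hlater : ∀ k l, k ≤ l → l ≤ n → Later (x k) (x l) := by
    intro k l hkl hl
    induction l, hkl using Nat.le_induction with
    | base => exact Later.refl _
    | succ l hkl ih =>
      obtain ⟨π, hπ⟩ := (hx l (by omega)).2.2
      exact (ih (by omega)).trans (Later.of_exec (exec_withStart.1 hπ))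
  have hj' := hx j hj
  refine not_isSubgoal_of_later (hlater j (j + 1) (by omega) (by omega)) ?_
    (fun h => hj'.1 (unserved_eq_zero_iff.1 h)) ((mem_subgoals I _ _).1 hj'.2.1)
  exact heq ▸ hlater (j + 1) n (by omega) le_rfl

/-! ### Closest subgoal states are not dead ends. -/

/-- A state in which all children are served is the only closest subgoal state of itself. Otherwise
the closest subgoal states are reached in one step, or else in two steps by moving a tray first.
In all cases supplies remain sufficient. -/
theorem supplied_of_mem_closestSubgoals (I : Instance) {σ' : Set (Atom I.task)}
    (h : σ' ∈ sketch.closestSubgoals I I.start) : Invariant σ' ∧ Supplied σ' := by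
  obtain ⟨hσ', π, hπ, -, hopt⟩ := h
  have hi := I.invariant
  have hs := I.supplied
  replace hπ := exec_withStart.1 hπ
  replace hσ' := (mem_subgoals I _ _).1 hσ'
  by_cases hσ : (counts I.start).unserved = 0
  · have hl : π.length ≤ 0 := hopt [] ⟨I.start, (mem_subgoals I _ _).2 (.inl hσ), rfl⟩
    obtain rfl := List.length_eq_zero_iff.1 (Nat.le_zero.1 hl)
    cases hπ
    exact ⟨hi, hs⟩
  · obtain ⟨ρ, τ, hρ, hτ, hsub, -⟩ := exists_subgoal hi hs hσ
    have hl : π.length ≤ 2 :=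
      (hopt ρ ⟨τ, (mem_subgoals I _ _).2 hsub, exec_withStart.2 hτ⟩).trans hρ
    match π, hl, hπ, hopt with
    | [], _, hπ, _ => cases hπ; exact ⟨hi, hs⟩
    | [a], _, hπ, _ =>
      obtain ⟨ha, rfl⟩ := hπ
      exact ⟨hi.step ha,
        ((progress_of_isSubgoal hi hσ ha hσ').supplied hi hs ha).1⟩
    | [a, b], _, hπ, hopt =>
      obtain ⟨ha, hb, rfl⟩ := hπ
      have hno : ∀ a : Action I.task, a.pre ⊆ I.start → ¬ Progress I.start a := by
        intro d hd hp
        have : 2 ≤ 1 := hopt [d] ⟨step I.start d,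
          (mem_subgoals I _ _).2 (hp.isSubgoal hi hd), hd, rfl⟩
        omega
      obtain ⟨⟨t, p, q, rfl⟩, hp⟩ := moveTray_of_isSubgoal hi hσ hno ha hb hσ'
      have hi' : Invariant (step I.start (.moveTray t p q)) := hi.step ha
      exact ⟨hi'.step hb, (hp.supplied hi' (hs.moveTray t p q) hb).1⟩

theorem noDeadEnds_sketch : sketch.NoDeadEnds := fun I _ h hd =>
  have h' := supplied_of_mem_closestSubgoals I h
  h'.2.not_deadEnd h'.1 (deadEnd_withStart.1 hd)

/-! ### Width at most one. -/

theorem trayAt_of_step {a : Action T} {t : T.Tray} {q : Place T} (h : .trayAt t q ∈ step σ a)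
    (h' : .trayAt t q ∉ σ) : ∃ p, a = .moveTray t p q := by
  have h1 : .trayAt t q ∈ a.adds := h.resolve_left fun h => h' h.1
  cases a <;> simp_all [Action.adds]

theorem onTray_of_step {a : Action T} {s : T.Sandwich} {t : T.Tray} (h : .onTray s t ∈ step σ a)
    (h' : .onTray s t ∉ σ) : a = .putOnTray s t := by
  have h1 : .onTray s t ∈ a.adds := h.resolve_left fun h => h' h.1
  cases a <;> simp_all [Action.adds]

/-- While the tray is not in the kitchen, putting the kitchen sandwich on it within two steps leads
to a subgoal state. -/
theorem NeedsTray.isSubgoal (hi : Invariant σ) {s : T.Sandwich} {t : T.Tray}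
    (h : NeedsTray σ s t) {π : List (Action T)} {σ' : Set (Atom T)} (hl : π.length ≤ 2)
    (hπ : (problem T).Exec σ π σ') (hσ' : .onTray s t ∈ σ') : IsSubgoal σ σ' := by
  have h0 := hi.kitchen_onTray s t h.1
  -- One step is too short, as the tray is away. In two steps the actions are forced: fetch the
  -- tray, then load it. The length bound matters, since a third action could make a sandwich and
  -- restore `sk`.
  have h1 : ∀ a : Action T, a.pre ⊆ σ → .onTray s t ∉ step σ a := by
    intro a ha hst
    obtain rfl := onTray_of_step hst h0
    exact h.2 (ha (.inr rfl))
  match π, hl, hπ with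
  | [], _, hπ => cases hπ; exact (h0 hσ').elim
  | [a], _, hπ =>
    obtain ⟨ha, rfl⟩ := hπ
    exact (h1 a ha hσ').elim
  | [a, b], _, hπ =>
    obtain ⟨ha, hb, rfl⟩ := hπ
    obtain rfl := onTray_of_step hσ' (h1 a ha)
    obtain ⟨p, rfl⟩ := trayAt_of_step (hb (.inr rfl)) h.2
    have h2 : (counts (step (step σ (.moveTray t p .kitchen)) (.putOnTray s t))).sk + 1 =
        (counts (step σ (.moveTray t p .kitchen))).sk :=
      (counts_putOnTray hb).2.2.2.2.2.2.2.2.2.1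
    rw [counts_moveTray] at h2
    exact .inr (.inr (.inl (Nat.lt_of_succ_le h2.le)))

/-- No length bound is needed here: children stay served, so serving `c` lowers `ua` for good if `c`
is allergic, and otherwise lowers `unserved` from a state with `ua = 0`. -/
theorem NeedsDelivery.isSubgoal {s : T.Sandwich} {t : T.Tray} {c : T.Child}
    (h : NeedsDelivery σ s t c) {σ' : Set (Atom T)} (hl : Later σ σ')
    (hσ' : .served c ∈ σ') : IsSubgoal σ σ' := by
  obtain ⟨-, -, hc, ⟨hca, -⟩ | ⟨-, hua⟩⟩ := h
  · refine .inr (.inr (.inr (.inl (Set.ncard_lt_ncard ?_))))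
    refine ⟨fun x hx => ⟨(hl.allergic x).2 hx.1, fun h => hx.2 (hl.served x h)⟩, fun hsub => ?_⟩
    exact (hsub ⟨hca, hc⟩).2 hσ'
  · refine .inr (.inr (.inr (.inr (.inr ⟨hua, Set.ncard_lt_ncard ?_⟩))))
    exact ⟨fun x hx h => hx (hl.served x h), fun hsub => hsub hc hσ'⟩

/-- The problem of reaching a closest subgoal state. -/
abbrev subproblem (I : Instance) : PlanningProblem :=
  (problems I).withGoal (sketch.closestSubgoals I (problems I).start)

/-- This excludes the case of the width in which the number of atoms is taken. -/
theorem not_deadEnd_subproblem (I : Instance) :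
    ¬ (subproblem I).DeadEnd (subproblem I).start := by
  have h : ∃ π, (problems I).IsPlan I.start (sketch.subgoals I I.start) π := by
    by_cases hσ : (counts I.start).unserved = 0
    · exact ⟨[], I.start, (mem_subgoals I _ _).2 (.inl hσ), rfl⟩
    · obtain ⟨ρ, τ, -, hτ, hsub, -⟩ := exists_subgoal I.invariant I.supplied hσ
      exact ⟨ρ, τ, (mem_subgoals I _ _).2 hsub, exec_withStart.2 hτ⟩
  obtain ⟨π, hπ⟩ := exists_isOptimalPlan h
  exact not_not.2 ⟨π, isPlan_withGoal.2 (isOptimalPlan_closest.2 hπ).1⟩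

theorem width_subproblem_le_one (I : Instance) : (subproblem I).width ≤ 1 := by
  by_cases hshort : ∃ π, (subproblem I).IsPlan (subproblem I).start (subproblem I).goal π ∧
      π.length ≤ 1
  · unfold width
    rw [if_neg (not_deadEnd_subproblem I), if_pos hshort]
    exact zero_le
  have hi := I.invariant
  have hlong : ∀ π, (problems I).IsPlan I.start (sketch.subgoals I I.start) π → 2 ≤ π.length := by
    intro π hπ
    by_contra hlt
    obtain ⟨ρ, hρ⟩ := exists_isOptimalPlan ⟨π, hπ⟩
    refine hshort ⟨ρ, isPlan_withGoal.2 (isOptimalPlan_closest.2 hρ).1, ?_⟩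
    have : ρ.length ≤ π.length := hρ.2 π hπ
    exact this.trans (Nat.le_of_lt_succ (not_le.1 hlt))
  have hσ : (counts I.start).unserved ≠ 0 := by
    intro h0
    have : 2 ≤ 0 := hlong [] ⟨I.start, (mem_subgoals I _ _).2 (.inl h0), rfl⟩
    omega
  rcases exists_progress hi I.supplied hσ with ⟨a, ha, hp⟩ | ⟨s, t, hst⟩ | ⟨s, t, c, hst⟩
  · have : 2 ≤ 1 := hlong [a] ⟨step I.start a,
      (mem_subgoals I _ _).2 (hp.isSubgoal hi ha), ha, rfl⟩
    omega
  · obtain ⟨p, hp⟩ := hi.trayAt t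
    refine width_le_one (not_deadEnd_subproblem I) (isOptimalChain_of_two_steps (P := problems I)
      (x₀ := .trayAt t p) (x₁ := .trayAt t .kitchen) (x₂ := .onTray s t) hlong hp hst.2
      ⟨.moveTray t p .kitchen, Set.singleton_subset_iff.2 hp, .inr rfl⟩ ?_ ?_)
    · intro a ha ht
      -- Admissibility concerns every action that brings the tray here. Its origin `p'` need not be
      -- `p`, as `Invariant` does not assert that a tray has only one place.
      obtain ⟨p', rfl⟩ := trayAt_of_step ht hst.2
      exact ⟨.putOnTray s t, hst.progress p', .inr rfl⟩
    · intro π σ' hl hπ hσ'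
      exact (mem_subgoals I _ _).2 (hst.isSubgoal hi hl (exec_withStart.1 hπ) hσ')
  · obtain ⟨p, hp⟩ := hi.trayAt t
    refine width_le_one (not_deadEnd_subproblem I) (isOptimalChain_of_two_steps (P := problems I)
      (x₀ := .trayAt t p) (x₁ := .trayAt t (.table (I.task.seat c))) (x₂ := .served c) hlong hp
      hst.2.1 ⟨.moveTray t p (.table (I.task.seat c)), Set.singleton_subset_iff.2 hp, .inr rfl⟩
      ?_ ?_)
    · intro a ha ht
      obtain ⟨p', rfl⟩ := trayAt_of_step ht hst.2.1
      obtain ⟨b, hb, -, hc⟩ := hst.progress hi p'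
      exact ⟨b, hb, .inr hc⟩
    · intro π σ' _ hπ hσ'
      exact (mem_subgoals I _ _).2 (hst.isSubgoal (Later.of_exec (exec_withStart.1 hπ)) hσ')

/-! ### An instance of width one. -/

/-- A task with one object of each kind, no gluten-free ingredients and no allergic child. -/
abbrev singletonTask : Task where
  Child := Unit
  Bread := Unit
  Content := Unit
  Sandwich := Unit
  Tray := Unit
  Table := Unit
  glutenFreeBread := ∅
  glutenFreeContent := ∅
  allergic := ∅
  seat := id

/-- The state of the singleton task after making the sandwich and moving the tray to the table. -/
def trayAwayState : Set (Atom singletonTask) :=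
  step (step (initially singletonTask) (.makeSandwich () () ()))
    (.moveTray () .kitchen (.table ()))

theorem reachable_trayAwayState :
    (problem singletonTask).Reachable (initially singletonTask) trayAwayState := by
  refine ⟨[.makeSandwich () () (), .moveTray () .kitchen (.table ())], ?_, ?_, rfl⟩
  · rintro x (rfl | rfl | rfl) <;> exact trivial
  · refine Set.singleton_subset_iff.2 (.inl ⟨rfl, ?_⟩)
    rintro (h | h | h) <;> cases h

theorem unserved_trayAwayState : (counts trayAwayState).unserved = 1 := by
  simp [counts, trayAwayState, mem_step, Action.adds, initially]

theorem supplied_trayAwayState : Supplied trayAwayState := by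
  have h1 := unserved_trayAwayState
  have h2 : (counts trayAwayState).avail = 1 := by
    simp [counts, trayAwayState, mem_step, Action.adds, Action.dels]
  have h3 : (counts trayAwayState).ua = 0 := by
    simp [counts, trayAwayState, mem_step, Action.adds, initially]
  exact ⟨.inl ⟨()⟩, by omega, by omega, by omega, by omega, by omega, by omega⟩

/-- An instance in which the closest subgoal state is two steps away. -/
def trayAwayInstance : Instance where
  task := singletonTask
  start := trayAwayState
  reachable := reachable_trayAwayState
  solvable := supplied_trayAwayState.not_deadEnd (.of_reachable reachable_trayAwayState)

/-- The only sandwich has been made, it is still in the kitchen, and the empty tray is at the table: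
only tray moves are applicable. -/
theorem not_progress_trayAwayState {a : Action singletonTask} (ha : a.pre ⊆ trayAwayState) :
    ¬ Progress trayAwayState a := by
  cases a <;>
  simp [Action.pre, Set.insert_subset_iff, trayAwayState, mem_step, Action.adds, Action.dels,
    initially] at ha
  exact id

theorem one_le_width_trayAwayInstance : 1 ≤ (subproblem trayAwayInstance).width := by
  refine one_le_width (not_deadEnd_subproblem _) ?_
  have hi := trayAwayInstance.invariant
  have hσ : (counts trayAwayInstance.start).unserved ≠ 0 :=
    unserved_trayAwayState ▸ one_ne_zero
  rintro ⟨π, ⟨σ', hσ', hπ⟩, hl⟩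
  replace hσ' := (mem_subgoals trayAwayInstance _ _).1 hσ'.1
  match π, hl, hπ with
  | [], _, hπ =>
    cases hπ
    exact not_isSubgoal_of_later (Later.refl _) (Later.refl _) hσ hσ'
  | [a], _, hπ =>
    obtain ⟨ha, rfl⟩ := hπ
    exact not_progress_trayAwayState ha (progress_of_isSubgoal hi hσ ha hσ')

theorem hasWidth_sketch : sketch.HasWidth 1 := by
  refine ⟨noDeadEnds_sketch, ⟨trayAwayInstance, ?_⟩, ?_⟩
  · exact le_antisymm (width_subproblem_le_one _) one_le_width_trayAwayInstance
  · rintro _ ⟨I, rfl⟩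
    exact width_subproblem_le_one I

end Childsnack

theorem mainTheorem3 :
    Sketch.ClosedClass Childsnack.problems ∧
    Childsnack.sketch.Acyclic ∧
    Childsnack.sketch.HasWidth 1 ∧
    Childsnack.sketch.NoDeadEnds :=
  ⟨Childsnack.closedClass_problems, Childsnack.acyclic_sketch, Childsnack.hasWidth_sketch,
    Childsnack.noDeadEnds_sketch⟩
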